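/- **Setting.** A contextual decision process (CDP) consists of a context space $\mathcal X$, a finite action set $\mathcal A$ with $|\mathcal A|=K$, a horizon $H\ge 1$, a law of the first context $x_1$, and, for every history $(x_1,a_1,r_1,\dots,x_h,a_h)$, a law of $(r_h,x_{h+1})$. However the actions are chosen, $r_h\ge 0$ and $\sum_{h=1}^H r_h\le 1$ almost surely. A policy $\pi:\mathcal X\to\mathcal A$ has value $V^\pi=\mathbb E[\sum_{h=1}^H r_h\mid a_{1:H}\sim\pi]$. Let $\mathcal F$ be a finite class of $N$ functions $f:\mathcal X\times\mathcal A\to[0,1]$, with greedy policies $\pi_f(x)\in\arg\max_a f(x,a)$ (arbitrary tie-breaking); by convention $f(x_{H+1},\cdot)=0$. The average Bellman error is $$\mathcal E(f,\pi,h)=\mathbb E\big[f(x_h,a_h)-r_h-f(x_{h+1},a_{h+1})\mid a_{1:h-1}\sim\pi,\ a_{h:h+1}\sim\pi_f\big].$$ A function $f\in\mathcal F$ is valid if $\mathcal E(f,\pi_{f'},h)=0$ for all $f'\in\mathcal F$, $h\in[H]$. Assume that a valid function exists and let $V^*_{\mathcal F}=\max\{V^{\pi_f}: f\in\mathcal F\text{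 valid}\}$. A Bellman factorization of rank $M\ge 1$ and norm parameter $\zeta$ consists of maps $\nu_h,\xi_h:\mathcal F\to\mathbb R^M$, $h\in[H]$, with $\mathcal E(f,\pi_{f'},h)=\langle\nu_h(f'),\xi_h(f)\rangle$ and $\|\nu_h(f')\|_2\|\xi_h(f)\|_2\le\zeta$ for all $f,f'\in\mathcal F$, $h\in[H]$. **Algorithm OLIVE.** Collect $n_{\rm est}$ episodes with arbitrary actions and let $\hat V_f$ be the average of $f(x_1,\pi_f(x_1))$ over them. Put $\mathcal F_0=\mathcal F$. For $t=1,2,\dots$: choose any $f_t\in\arg\max_{f\in\mathcal F_{t-1}}\hat V_f$ and put $\pi_t=\pi_{f_t}$; collect $n_{\rm eval}$ fresh episodes following $\pi_t$, and let $\tilde{\mathcal E}_h$ be the average of $f_t(x_h,a_h)-r_h-f_t(x_{h+1},a_{h+1})$ over them. If $\sum_{h=1}^H\tilde{\mathcal E}_h\le 5\varepsilon/8$, halt and output $\hat\pi=\pi_t$. Otherwise pick any $h_t$ with $\tilde{\mathcal E}_{h_t}\ge 5\varepsilon/(8H)$; collect $n$ fresh episodes following $\pi_t$, except that $a_{h_t}$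 is uniformly random; for each $f$ let $\hat{\mathcal E}(f)$ be the average of $K\,\mathbf 1[a_{h_t}=\pi_f(x_{h_t})]\,\big(f(x_{h_t},a_{h_t})-r_{h_t}-f(x_{h_t+1},\pi_f(x_{h_t+1}))\big)$; put $\mathcal F_t=\{f\in\mathcal F_{t-1}:|\hat{\mathcal E}(f)|\le\phi\}$. **Theorem.** There are universal constants $c>0$ and $k\in\mathbb N$ such that the following holds. Let $\varepsilon,\delta\in(0,1)$, and let a CDP and a class $\mathcal F$ as above admit a Bellman factorization of rank $M$ and norm parameter $\zeta$. Put $L=\log(6H\sqrt M\zeta/\varepsilon)$ and assume $L\ge 1$ (which holds, for example, if $\zeta\ge 1/2$). Run OLIVE with $\phi=\frac{\varepsilon}{12H\sqrt M}$ and $$n_{\rm est}=\Big\lceil\tfrac{32}{\varepsilon^2}\log\tfrac{6N}{\delta}\Big\rceil,\quad n_{\rm eval}=\Big\lceil\tfrac{288H^2}{\varepsilon^2}\log\tfrac{12H^2ML}{\delta}\Big\rceil,\quad n=\Big\lceil\tfrac{4608H^2MK}{\varepsilon^2}\log\tfrac{12NHML}{\delta}\Big\rceil .$$ Then, however the open choices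 of the algorithm are made, with probability at least $1-\delta$ it halts, outputs a policy $\hat\pi$ with $V^{\hat\pi}\ge V^*_{\mathcal F}-\varepsilon$, and uses at most $$c\,\frac{M^2H^3K}{\varepsilon^2}\,\max\Big\{1,\log\frac{N\zeta}{\delta}\Big\}\Big(1+\log\frac{MHK(1+\zeta)}{\varepsilon}\Big)^{k}$$ episodes, that is, $\tilde O\big(M^2H^3K\log(N\zeta/\delta)/\varepsilon^2\big)$ episodes, where $\tilde O$ hides factors polylogarithmic in everything except $N$ and $\delta$. -/

import Mathlib

open MeasureTheory ProbabilityTheory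
open scoped RealInnerProductSpace

universe u v

namespace OLIVE

noncomputable section

/-! ### Sequentially generated data -/

/-- Append one more record to a finite sequence of records (with an initial datum). -/
def extend {S : Type*} {R : Type*} {t : ℕ} (p : (S × (Fin t → R)) × R) :
    S × (Fin (t + 1) → R) :=
  (p.1.1, Fin.snoc (α := fun _ => R) p.1.2 p.2)

theorem measurable_extend {S : Type*} {R : Type*} [MeasurableSpace S] [MeasurableSpace R]
    {t : ℕ} : Measurable (extend : (S × (Fin t → R)) × R → S × (Fin (t + 1) → R)) := by
  refine Measurable.prodMk (by fun_prop) (measurable_pi_iff.2 fun i => ?_)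
  refine Fin.lastCases ?_ (fun j => ?_) i
  · simpa using measurable_snd
  · simp only [Fin.snoc_castSucc]
    fun_prop

/-- The joint law of an initial datum (with law `μ₀`) and of the first `t` records, when the
record number `k` is drawn from `κ k` given everything that was drawn before it. -/
def seqLaw {S : Type*} {R : Type*} [MeasurableSpace S] [MeasurableSpace R] (μ₀ : Measure S)
    (κ : (k : ℕ) → Kernel (S × (Fin k → R)) R) : (t : ℕ) → Measure (S × (Fin t → R))
  | 0 => μ₀.map (fun s => (s, Fin.elim0))
  | t + 1 => ((seqLaw μ₀ κ t) ⊗ₘ (κ t)).map extend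

theorem isProbabilityMeasure_seqLaw {S : Type*} {R : Type*} [MeasurableSpace S]
    [MeasurableSpace R] (μ₀ : Measure S) [IsProbabilityMeasure μ₀]
    (κ : (k : ℕ) → Kernel (S × (Fin k → R)) R) (hκ : ∀ k, IsMarkovKernel (κ k)) (t : ℕ) :
    IsProbabilityMeasure (seqLaw μ₀ κ t) := by
  induction t with
  | zero => exact Measure.isProbabilityMeasure_map (by fun_prop)
  | succ t ih =>
    have := hκ t
    exact Measure.isProbabilityMeasure_map measurable_extend.aemeasurable

/-! ### Contextual decision processes

Levels `1, …, H` are the indices `0, …, H - 1` here. -/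

/-- `Hist X A h` is the type of histories `(x₁, a₁, r₁, x₂, …, a_h, r_h, x_{h+1})` after `h`
complete steps; `Hist X A H` is the type of full trajectories (episodes). -/
abbrev Hist (X : Type u) (A : Type v) (h : ℕ) : Type (max u v) := X × (Fin h → A × ℝ × X)

/-- A contextual decision process with horizon `H`: a law of the first context, and, for each
history and each next action, a law of the next reward and the next context. -/
structure CDP (X : Type u) (A : Type v) [MeasurableSpace X] [MeasurableSpace A] (H : ℕ) where
  init : Measure X
  init_prob : IsProbabilityMeasure init
  step : (h : ℕ) → Kernel (Hist X A h × A) (ℝ × X)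
  step_markov : ∀ h, IsMarkovKernel (step h)

/-- A general way of choosing actions within an episode: randomized and dependent on the
whole history. -/
structure Behaviour (X : Type u) (A : Type v) [MeasurableSpace X] [MeasurableSpace A] where
  act : (h : ℕ) → Kernel (Hist X A h) A
  act_markov : ∀ h, IsMarkovKernel (act h)

/-- A policy `X → A`. -/
abbrev Policy (X : Type u) (A : Type v) [MeasurableSpace X] [MeasurableSpace A] :
    Type (max u v) := {π : X → A // Measurable π}

section Trajectories

variable {X : Type u} {A : Type v} {H : ℕ}

/-- The contexts `x₁, …, x_{h+1}` of a history. -/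
def ctx {h : ℕ} (τ : Hist X A h) : Fin (h + 1) → X :=
  Fin.cons (α := fun _ => X) τ.1 (fun j => (τ.2 j).2.2)

/-- The actions `a₁, …, a_h` of a history. -/
def act {h : ℕ} (τ : Hist X A h) (j : Fin h) : A := (τ.2 j).1

/-- The rewards `r₁, …, r_h` of a history. -/
def rew {h : ℕ} (τ : Hist X A h) (j : Fin h) : ℝ := (τ.2 j).2.1

theorem measurable_ctx_last [MeasurableSpace X] [MeasurableSpace A] (h : ℕ) :
    Measurable (fun τ : Hist X A h => ctx τ (Fin.last h)) := by
  cases h with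
  | zero => exact measurable_fst
  | succ n =>
    have : (fun τ : Hist X A (n + 1) => ctx τ (Fin.last (n + 1)))
        = fun τ => (τ.2 (Fin.last n)).2.2 := by
      funext τ
      rw [← Fin.succ_last]
      simp only [ctx, Fin.cons_succ]
    rw [this]
    fun_prop

end Trajectories

section Processes

variable {X : Type u} {A : Type v} [MeasurableSpace X] [MeasurableSpace A] {H : ℕ}

/-- The kernel "apply the policy `π` to the current context". -/
def Policy.kernel (π : Policy X A) (h : ℕ) : Kernel (Hist X A h) A :=
  Kernel.deterministic (fun τ => π.1 (ctx τ (Fin.last h))) (π.2.comp (measurable_ctx_last h))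

instance Policy.kernel_markov (π : Policy X A) (h : ℕ) : IsMarkovKernel (π.kernel h) := by
  unfold Policy.kernel
  infer_instance

/-- Follow `π` on all levels. -/
def follow (π : Policy X A) : Behaviour X A where
  act := fun h => π.kernel h
  act_markov := fun _ => inferInstance

/-- Follow `π` on the levels before `h`, and `π'` from level `h` on. -/
def rollIn (π π' : Policy X A) (h : ℕ) : Behaviour X A where
  act := fun k => if k < h then π.kernel k else π'.kernel k
  act_markov := fun k => by split_ifs <;> infer_instance

/-- Follow `π` on all levels but level `h`, where the action is uniformly random. -/
def explore [Fintype A] [Nonempty A] (π : Policy X A) (h : ℕ) : Behaviour X A where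
  act := fun k => if k = h then Kernel.const _ (PMF.uniformOfFintype A).toMeasure
    else π.kernel k
  act_markov := fun k => by split_ifs <;> infer_instance

/-- The law of an episode when actions are chosen by `β`. -/
def CDP.law (C : CDP X A H) (β : Behaviour X A) : Measure (Hist X A H) :=
  seqLaw C.init (fun h => (β.act h) ⊗ₖ (C.step h)) H

instance CDP.law_prob (C : CDP X A H) (β : Behaviour X A) :
    IsProbabilityMeasure (C.law β) := by
  have := C.init_prob
  refine isProbabilityMeasure_seqLaw _ _ (fun k => ?_) H
  have := C.step_markov k
  have := β.act_markov k
  infer_instance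

/-- Rewards are nonnegative with sum at most one, however the actions are chosen. -/
def CDP.BoundedRewards (C : CDP X A H) : Prop :=
  ∀ β : Behaviour X A, ∀ᵐ τ ∂(C.law β), (∀ h, 0 ≤ rew τ h) ∧ ∑ h, rew τ h ≤ 1

/-- The value of a policy. -/
def CDP.value (C : CDP X A H) (π : Policy X A) : ℝ :=
  ∫ τ, ∑ h, rew τ h ∂(C.law (follow π))

end Processes

/-! ### Value functions, Bellman errors, Bellman factorizations -/

/-- A class `f₁, …, f_N` of (measurable) functions `X × A → [0, 1]`, each with a (measurable)
greedy policy `x ↦ argmax_a f(x, a)`, ties being broken in an arbitrary way. -/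
structure ValueClass (X : Type u) (A : Type v) [MeasurableSpace X] [MeasurableSpace A]
    (N : ℕ) where
  val : Fin N → X → A → ℝ
  val_mem : ∀ i x a, val i x a ∈ Set.Icc (0 : ℝ) 1
  val_measurable : ∀ i a, Measurable (fun x => val i x a)
  greedy : Fin N → Policy X A
  greedy_max : ∀ i x a, val i x a ≤ val i x ((greedy i).1 x)

section Bellman

variable {X : Type u} {A : Type v} [MeasurableSpace X] [MeasurableSpace A] {H N : ℕ}

/-- `f(x_h, a_h) - r_h - f(x_{h+1}, a_{h+1})` on a trajectory, where all functions vanish at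
level `H + 1`. -/
def residual (F : ValueClass X A N) (i : Fin N) (h : Fin H) (τ : Hist X A H) : ℝ :=
  F.val i (ctx τ h.castSucc) (act τ h) - rew τ h
    - (if hh : (h : ℕ) + 1 < H then F.val i (ctx τ h.succ) (act τ ⟨h + 1, hh⟩) else 0)

/-- The average Bellman error of `f_i` under roll-in policy `π` at level `h`. -/
def bellmanError (C : CDP X A H) (F : ValueClass X A N) (i : Fin N) (π : Policy X A)
    (h : Fin H) : ℝ :=
  ∫ τ, residual F i h τ ∂(C.law (rollIn π (F.greedy i) h))

/-- `f_i` is valid: all its Bellman equations hold, over roll-ins with greedy policies. -/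
def Valid (C : CDP X A H) (F : ValueClass X A N) (i : Fin N) : Prop :=
  ∀ (j : Fin N) (h : Fin H), bellmanError C F i (F.greedy j) h = 0

/-- The optimal value: the largest value of the greedy policy of a valid function. -/
def optValue (C : CDP X A H) (F : ValueClass X A N) : ℝ :=
  ⨆ i : {i : Fin N // Valid C F i}, C.value (F.greedy i.1)

/-- Bellman factorization with Bellman rank `M` and norm parameter `ζ`. -/
def BellmanFactorization (C : CDP X A H) (F : ValueClass X A N) (M : ℕ) (ζ : ℝ) : Prop :=
  ∃ ν ξ : Fin H → Fin N → EuclideanSpace ℝ (Fin M), ∀ (i j : Fin N) (h : Fin H),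
    bellmanError C F i (F.greedy j) h = ⟪ν h j, ξ h i⟫ ∧ ‖ν h j‖ * ‖ξ h i‖ ≤ ζ

end Bellman

/-! ### The algorithm -/

/-- The three sample sizes. -/
structure SampleSizes where
  nEst : ℕ
  nEval : ℕ
  nExp : ℕ

/-- What is chosen and observed in one iteration of the loop: the index of `f_t`, the episodes
used for the evaluation of `f_t`, the level `h_t`, the episodes of the exploration step. -/
abbrev Record (X : Type u) (A : Type v) (H N : ℕ) (m : SampleSizes) : Type (max u v) :=
  Fin N × (Fin m.nEval → Hist X A H) × Fin H × (Fin m.nExp → Hist X A H)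

/-- The initial episodes and the records of the first `t` iterations. -/
abbrev Run (X : Type u) (A : Type v) (H N : ℕ) (m : SampleSizes) (t : ℕ) : Type (max u v) :=
  (Fin m.nEst → Hist X A H) × (Fin t → Record X A H N m)

section Algorithm

variable {X : Type u} {A : Type v} [MeasurableSpace X] [MeasurableSpace A] {H N : ℕ}

/-- The empirical predicted value `(1/n) ∑ f(x₁, π_f(x₁))`. -/
def empValue (F : ValueClass X A N) {n : ℕ} (d : Fin n → Hist X A H) (i : Fin N) : ℝ :=
  (1 / (n : ℝ)) * ∑ k, F.val i (ctx (d k) 0) ((F.greedy i).1 (ctx (d k) 0))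

/-- The empirical Bellman error of `f_i` at level `h` on episodes that follow its own policy. -/
def empOwnError (F : ValueClass X A N) {n : ℕ} (d : Fin n → Hist X A H) (i : Fin N)
    (h : Fin H) : ℝ :=
  (1 / (n : ℝ)) * ∑ k, residual F i h (d k)

/-- The importance weighted empirical Bellman error of `f_i` at level `h`, where again `f_i`
vanishes at level `H + 1`. -/
def empError [Fintype A] [DecidableEq A] (F : ValueClass X A N) {n : ℕ}
    (d : Fin n → Hist X A H) (i : Fin N) (h : Fin H) : ℝ :=
  (1 / (n : ℝ)) * ∑ k,
    (if act (d k) h = (F.greedy i).1 (ctx (d k) h.castSucc)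
      then (1 : ℝ) / (1 / (Fintype.card A : ℝ)) else 0) *
    (F.val i (ctx (d k) h.castSucc) (act (d k) h) - rew (d k) h
      - (if (h : ℕ) + 1 < H
          then F.val i (ctx (d k) h.succ) ((F.greedy i).1 (ctx (d k) h.succ)) else 0))

/-- The termination test for `f_i`, on the evaluation episodes `d`. -/
def Stops (F : ValueClass X A N) (ε : ℝ) {n : ℕ} (d : Fin n → Hist X A H) (i : Fin N) : Prop :=
  ∑ h, empOwnError F d i h ≤ 5 * ε / 8

/-- The functions that survive the elimination steps of the first `s` iterations. -/
def surviving [Fintype A] [DecidableEq A] (F : ValueClass X A N) (φ : ℝ) {m : SampleSizes}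
    {t : ℕ} (ω : Run X A H N m t) (s : ℕ) : Set (Fin N) :=
  {i | ∀ r : Fin t, (r : ℕ) < s → |empError F (ω.2 r).2.2.2 i (ω.2 r).2.2.1| ≤ φ}

/-- A way to make the choices that the algorithm leaves open, possibly at random and in
dependence on everything observed so far: the actions in the initial episodes, the maximizer
`f_t`, and the level `h_t`. -/
structure Choices [Fintype A] [DecidableEq A] (C : CDP X A H) (F : ValueClass X A N)
    (m : SampleSizes) (ε φ : ℝ) where
  /-- the law of the next initial episode, given the previous ones: actions are arbitrary -/
  start : (k : ℕ) → Kernel (Unit × (Fin k → Hist X A H)) (Hist X A H)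
  start_spec : ∀ k ω, ∃ β : Behaviour X A, start k ω = C.law β
  /-- the choice of `f_t`: a surviving function with the largest empirical predicted value -/
  pick : (t : ℕ) → Kernel (Run X A H N m t) (Fin N)
  pick_markov : ∀ t, IsMarkovKernel (pick t)
  pick_spec : ∀ t (ω : Run X A H N m t), (surviving F φ ω t).Nonempty →
    ∀ᵐ i ∂(pick t ω), i ∈ surviving F φ ω t ∧
      ∀ j ∈ surviving F φ ω t, empValue F ω.1 j ≤ empValue F ω.1 i
  /-- the choice of `h_t`: a level with large empirical Bellman error, unless the algorithm
  terminates -/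
  level : (t : ℕ) → Kernel ((Run X A H N m t × Fin N) × (Fin m.nEval → Hist X A H)) (Fin H)
  level_markov : ∀ t, IsMarkovKernel (level t)
  level_spec : ∀ t (ω : Run X A H N m t) i d, ¬ Stops F ε d i →
    ∀ᵐ h ∂(level t ((ω, i), d)), 5 * ε / (8 * H) ≤ empOwnError F d i h

/-- `n` independent evaluation episodes that follow the greedy policy of `f_i`. -/
def evalKernel (C : CDP X A H) (F : ValueClass X A N) (n : ℕ) :
    Kernel (Fin N) (Fin n → Hist X A H) :=
  Kernel.ofFunOfCountable (fun i => Measure.pi (fun _ => C.law (follow (F.greedy i))))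

/-- `n` independent exploration episodes that follow the greedy policy of `f_i`, except for a
uniformly random action at level `h`. -/
def exploreKernel [Fintype A] [Nonempty A] (C : CDP X A H) (F : ValueClass X A N) (n : ℕ) :
    Kernel (Fin N × Fin H) (Fin n → Hist X A H) :=
  Kernel.ofFunOfCountable
    (fun p => Measure.pi (fun _ => C.law (explore (F.greedy p.1) (p.2 : ℕ))))

variable [Fintype A] [DecidableEq A] [Nonempty A] {C : CDP X A H} {F : ValueClass X A N}
  {m : SampleSizes} {ε φ : ℝ}

/-- The law of the record of iteration `t`, given the past. -/
def Choices.iteration (S : Choices C F m ε φ) (t : ℕ) :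
    Kernel (Run X A H N m t) (Record X A H N m) :=
  S.pick t ⊗ₖ
    ((evalKernel C F m.nEval).comap Prod.snd measurable_snd ⊗ₖ
      (S.level t ⊗ₖ
        (exploreKernel C F m.nExp).comap
          (fun q : ((Run X A H N m t × Fin N) × (Fin m.nEval → Hist X A H)) × Fin H =>
            (q.1.1.2, q.2))
          (by fun_prop)))

/-- The law of the initial episodes and of the first `t` iterations. The loop is continued
after the termination test is first met; those further records are not used below. -/
def Choices.law (S : Choices C F m ε φ) (t : ℕ) : Measure (Run X A H N m t) :=
  seqLaw ((seqLaw (Measure.dirac ()) S.start m.nEst).map Prod.snd) S.iteration t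

instance Choices.law_prob (S : Choices C F m ε φ) (t : ℕ) :
    IsProbabilityMeasure (S.law t) := by
  have h0 : IsProbabilityMeasure (seqLaw (Measure.dirac ()) S.start m.nEst) := by
    refine isProbabilityMeasure_seqLaw _ _ (fun k => ⟨fun ω => ?_⟩) _
    obtain ⟨β, hβ⟩ := S.start_spec k ω
    rw [hβ]
    infer_instance
  have h1 := Measure.isProbabilityMeasure_map (μ := seqLaw (Measure.dirac ()) S.start m.nEst)
    (f := Prod.snd) measurable_snd.aemeasurable
  refine isProbabilityMeasure_seqLaw _ _ (fun k => ?_) t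
  have h2 := S.pick_markov k
  have h3 := S.level_markov k
  have h4 : IsMarkovKernel (evalKernel C F m.nEval) := ⟨fun i => by
    change IsProbabilityMeasure (Measure.pi _)
    infer_instance⟩
  have h5 : IsMarkovKernel (exploreKernel C F m.nExp) := ⟨fun i => by
    change IsProbabilityMeasure (Measure.pi _)
    infer_instance⟩
  unfold Choices.iteration
  infer_instance

/-- In the run `ω` the algorithm halts in iteration number `s` (counted from zero): the
termination test is met there for the first time, and until then there always was a surviving
function to choose. -/
def HaltsAt (F : ValueClass X A N) (ε φ : ℝ) {t : ℕ} (ω : Run X A H N m t) (s : Fin t) :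
    Prop :=
  (surviving F φ ω s).Nonempty ∧ Stops F ε (ω.2 s).2.1 (ω.2 s).1 ∧
    ∀ r < s, ¬ Stops F ε (ω.2 r).2.1 (ω.2 r).1

/-- The policy that is returned when the algorithm halts in iteration `s`. -/
def output (F : ValueClass X A N) {t : ℕ} (ω : Run X A H N m t) (s : Fin t) : Policy X A :=
  F.greedy (ω.2 s).1

/-- The number of episodes that are used when the algorithm halts in iteration `s` (counted
from zero): the last iteration has no exploration step. -/
def episodes (m : SampleSizes) (s : ℕ) : ℕ := m.nEst + (s + 1) * m.nEval + s * m.nExp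

end Algorithm

end

end OLIVE

/-! The loop is followed for the fixed number `⌊2HML⌋` of iterations. On the event `GoodRun`, where
all estimates are within tolerance of their expectations and all open choices are admissible, the
argument is deterministic. Valid functions have Bellman error zero, hence are never eliminated, so
the maximizer `f_t` predicts at least the optimal value up to estimation error. Residuals telescope
along an episode, so predicted minus actual value of a greedy policy is the sum of its own Bellman
errors (`predValue_sub_value`). Passing the termination test therefore certifies near-optimality
(`GoodRun.value_ge`).

A failed test exhibits a level where `f_t` has Bellman error at least `ε/(2H)` under its own policy,
although, having survived, it has error at most `2φ` in absolute value under every earlier roll-in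
explored at that level. Through the factorization, `|⟨ν_t, ξ_t⟩| ≥ 3√M · 2φ` while `|⟨ν_s, ξ_t⟩| ≤
2φ` for `s < t`. Each such `t` makes a deep cut into an ellipsoid that contains the remaining
candidates: the determinant of its matrix grows by a factor above `e`, its trace stays bounded, and
AM-GM for the eigenvalues allows at most `2ML - 1` cuts per level (`card_le_of_deep_cuts`).

It remains to bound the probability of bad runs. Since `f_t` and `h_t` depend on the data, each
estimate is controlled conditionally on the past, uniformly in the past (`seqLaw_record_le`), and a
union bound follows (`Choices.law_not_goodRun_le`). In the exploration step importance weights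
convert the uniform action into the greedy one (`CDP.withDensity_impWeight`). Their second moment is
`K`, not `K²`, so a Bernstein-type bound (`lintegral_exp_le_of_sq_le`) makes the sample size linear
in `K`. -/

namespace OLIVE

/-! ### Marginals and conditional estimates for sequentially generated data -/

section SequentialLaw

variable {S R : Type*}

/-- Forget all but the first `t` records. -/
def trunc {t T : ℕ} (h : t ≤ T) (ω : S × (Fin T → R)) : S × (Fin t → R) :=
  (ω.1, fun j => ω.2 (Fin.castLE h j))

theorem trunc_extend {t T : ℕ} (h : t ≤ T) (p : (S × (Fin T → R)) × R) :
    trunc (h.trans T.le_succ) (extend p) = trunc h p.1 := by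
  refine Prod.ext rfl (funext fun j => ?_)
  change Fin.snoc (α := fun _ => R) p.1.2 p.2 (Fin.castLE h j).castSucc = _
  rw [Fin.snoc_castSucc]
  rfl

variable [MeasurableSpace S] [MeasurableSpace R]

@[fun_prop]
theorem measurable_trunc {t T : ℕ} (h : t ≤ T) :
    Measurable (trunc h : S × (Fin T → R) → S × (Fin t → R)) := by
  unfold trunc
  fun_prop

variable (μ : Measure S) [IsProbabilityMeasure μ] (κ κ' : (k : ℕ) → Kernel (S × (Fin k → R)) R)

theorem seqLaw_map_trunc (hκ : ∀ k, IsMarkovKernel (κ k)) {t T : ℕ} (h : t ≤ T) :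
    (seqLaw μ κ T).map (trunc h) = seqLaw μ κ t := by
  induction T, h using Nat.le_induction with
  | base => exact Measure.map_id
  | succ T h ih =>
    have := isProbabilityMeasure_seqLaw μ κ hκ T
    have := hκ T
    rw [seqLaw, Measure.map_map (measurable_trunc _) measurable_extend, ← ih]
    have : trunc (h.trans T.le_succ) ∘ (extend (S := S) (R := R)) = trunc h ∘ Prod.fst :=
      funext fun p => trunc_extend h p
    rw [this, ← Measure.map_map (measurable_trunc h) measurable_fst]
    congr 1
    exact Measure.fst_compProd _ _

/-- Later records do not affect the joint law of earlier ones, so `T` may be lowered to `t + 1`,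
where the claim is the recursive definition. This serves both for the levels of an episode and for
the iterations of the loop. -/
theorem seqLaw_map_record (hκ : ∀ k, IsMarkovKernel (κ k)) {t T : ℕ} (h : t < T) :
    (seqLaw μ κ T).map (fun ω => (trunc h.le ω, ω.2 ⟨t, h⟩)) = seqLaw μ κ t ⊗ₘ κ t := by
  have e : (fun ω : S × (Fin T → R) => (trunc h.le ω, ω.2 ⟨t, h⟩))
      = (fun ω : S × (Fin (t + 1) → R) => (trunc t.le_succ ω, ω.2 (Fin.last t))) ∘
        trunc (Nat.succ_le_of_lt h) := rfl
  rw [e, ← Measure.map_map (by fun_prop) (by fun_prop), seqLaw_map_trunc μ κ hκ, seqLaw,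
    Measure.map_map (by fun_prop) measurable_extend]
  convert Measure.map_id using 2
  funext p
  refine Prod.ext (trunc_extend le_rfl p) ?_
  simp [extend]

omit [IsProbabilityMeasure μ] in
variable {κ κ'} in
theorem seqLaw_congr {t : ℕ} (h : ∀ k < t, κ k = κ' k) : seqLaw μ κ t = seqLaw μ κ' t := by
  induction t with
  | zero => rfl
  | succ t ih => rw [seqLaw, seqLaw, ih fun k hk => h k (by omega), h t (by omega)]

/-- A bound on the conditional probability that is uniform in the past survives averaging over the
past. This handles the adaptive choices without any independence between iterations. -/
theorem seqLaw_record_le (hκ : ∀ k, IsMarkovKernel (κ k)) {t T : ℕ} (h : t < T)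
    {B : Set ((S × (Fin t → R)) × R)} (hB : MeasurableSet B) {p : ENNReal}
    (hp : ∀ ω, κ t ω (Prod.mk ω ⁻¹' B) ≤ p) :
    seqLaw μ κ T {ω | (trunc h.le ω, ω.2 ⟨t, h⟩) ∈ B} ≤ p := by
  have := isProbabilityMeasure_seqLaw μ κ hκ t
  have := hκ t
  have e := Measure.map_apply (μ := seqLaw μ κ T)
    (f := fun ω => (trunc h.le ω, ω.2 ⟨t, h⟩)) (by fun_prop) hB
  change _ = seqLaw μ κ T {ω | (trunc h.le ω, ω.2 ⟨t, h⟩) ∈ B} at e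
  rw [← e, seqLaw_map_record μ κ hκ, Measure.compProd_apply hB]
  calc _ ≤ ∫⁻ _, p ∂(seqLaw μ κ t) := lintegral_mono hp
    _ = p := by simp

/-- Integrating out the last record first costs at most a factor `c`, whatever the past. This
replaces independence for the initial episodes, whose actions may depend on previous episodes. -/
theorem lintegral_prod_seqLaw_le (hκ : ∀ k, IsMarkovKernel (κ k)) {G : R → ENNReal}
    (hG : Measurable G) {c : ENNReal} (hc : ∀ k ω, ∫⁻ r, G r ∂(κ k ω) ≤ c) (t : ℕ) :
    ∫⁻ ω, ∏ k, G (ω.2 k) ∂(seqLaw μ κ t) ≤ c ^ t := by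
  induction t with
  | zero =>
    have := isProbabilityMeasure_seqLaw μ κ hκ 0
    simp
  | succ t ih =>
    have := isProbabilityMeasure_seqLaw μ κ hκ t
    have := hκ t
    have hm : Measurable (fun p : (S × (Fin t → R)) × R => ∏ k, G ((extend p).2 k)) :=
      Measurable.comp (g := fun ω : S × (Fin (t + 1) → R) => ∏ k, G (ω.2 k)) (by fun_prop)
        measurable_extend
    rw [seqLaw, lintegral_map (by fun_prop) measurable_extend, Measure.lintegral_compProd hm]
    calc _ = ∫⁻ ω, (∏ k, G (ω.2 k)) * ∫⁻ r, G r ∂(κ t ω) ∂(seqLaw μ κ t) := by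
          refine lintegral_congr fun ω => ?_
          rw [← lintegral_const_mul _ hG]
          refine lintegral_congr fun r => ?_
          simp [extend, Fin.prod_univ_castSucc]
      _ ≤ ∫⁻ ω, (∏ k, G (ω.2 k)) * c ∂(seqLaw μ κ t) :=
          lintegral_mono fun ω => mul_le_mul_right (hc t ω) _
      _ = (∫⁻ ω, ∏ k, G (ω.2 k) ∂(seqLaw μ κ t)) * c := lintegral_mul_const _ (by fun_prop)
      _ ≤ c ^ (t + 1) := by rw [pow_succ]; gcongr

end SequentialLaw

/-! ### Composed kernels and product measures -/

section Kernels

variable {α β γ : Type*} [MeasurableSpace α] [MeasurableSpace β] [MeasurableSpace γ]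

theorem compProd_fst_le (κ : Kernel α β) [IsMarkovKernel κ] (η : Kernel (α × β) γ)
    [IsMarkovKernel η] (a : α) {B : Set β} (hB : MeasurableSet B) :
    (κ ⊗ₖ η) a {p | p.1 ∈ B} = κ a B := by
  have e := congrArg (fun k : Kernel α β => k a B) (Kernel.fst_compProd κ η)
  simp only [Kernel.fst_apply' _ _ hB] at e
  exact e

theorem compProd_le (κ : Kernel α β) [IsMarkovKernel κ] (η : Kernel (α × β) γ)
    [IsMarkovKernel η] (a : α) {B : Set (β × γ)} (hB : MeasurableSet B) {p : ENNReal}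
    (hp : ∀ b, η (a, b) (Prod.mk b ⁻¹' B) ≤ p) : (κ ⊗ₖ η) a B ≤ p := by
  rw [Kernel.compProd_apply hB]
  calc _ ≤ ∫⁻ _, p ∂(κ a) := lintegral_mono hp
    _ = p := by simp

theorem lintegral_prod_pi {n : ℕ} (P : Measure β) [IsProbabilityMeasure P] {G : β → ENNReal}
    (hG : Measurable G) :
    ∫⁻ d, ∏ k, G (d k) ∂(Measure.pi fun _ : Fin n => P) = (∫⁻ x, G x ∂P) ^ n := by
  rw [lintegral_prod_eq_prod_lintegral_of_indepFun (μ := Measure.pi fun _ : Fin n => P)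
    (s := Finset.univ) (X := fun k d => G (d k))
    (iIndepFun_pi (X := fun _ => G) fun _ => hG.aemeasurable) (fun _ => by fun_prop)]
  have : ∀ k : Fin n, ∫⁻ d, G (d k) ∂(Measure.pi fun _ : Fin n => P) = ∫⁻ x, G x ∂P := by
    intro k
    rw [← (measurePreserving_eval (fun _ : Fin n => P) k).lintegral_comp hG]
  simp [this]

end Kernels

/-! ### The exponential Markov inequality for averages -/

section Chernoff

variable {Ω : Type*} [MeasurableSpace Ω]

/-- Markov's inequality for the exponential of `l` times the sum. Only the joint exponential moment
enters, so the bound covers independent and adaptively generated samples alike. -/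
theorem measure_avg_ge_le (P : Measure Ω) {n : ℕ} (hn : 0 < n) {W : Fin n → Ω → ℝ}
    (hW : ∀ k, Measurable (W k)) {l x v : ℝ} (hl : 0 ≤ l)
    (h : ∫⁻ ω, ∏ k, ENNReal.ofReal (Real.exp (l * W k ω)) ∂P ≤ ENNReal.ofReal (Real.exp v) ^ n) :
    P {ω | x ≤ (1 / (n : ℝ)) * ∑ k, W k ω} ≤ ENNReal.ofReal (Real.exp (-(n * (l * x - v)))) := by
  have hn' : (0 : ℝ) < n := by exact_mod_cast hn
  have hsub : {ω | x ≤ (1 / (n : ℝ)) * ∑ k, W k ω} ⊆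
      {ω | ENNReal.ofReal (Real.exp (n * (l * x))) ≤
        ∏ k, ENNReal.ofReal (Real.exp (l * W k ω))} := by
    intro ω hω
    simp only [Set.mem_ofPred_eq] at hω ⊢
    rw [← ENNReal.ofReal_prod_of_nonneg (fun _ _ => (Real.exp_pos _).le), ← Real.exp_sum,
      ← Finset.mul_sum]
    refine ENNReal.ofReal_le_ofReal (Real.exp_le_exp.2 ?_)
    have : n * x ≤ ∑ k, W k ω := by
      rw [one_div, ← div_eq_inv_mul, le_div_iff₀ hn'] at hω
      linarith
    nlinarith
  have key := (mul_meas_ge_le_lintegral (μ := P)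
    (f := fun ω => ∏ k, ENNReal.ofReal (Real.exp (l * W k ω))) (by fun_prop)
    (ENNReal.ofReal (Real.exp (n * (l * x))))).trans h
  have e : ENNReal.ofReal (Real.exp (-(n * (l * x - v)))) =
      ENNReal.ofReal (Real.exp (-(n * (l * x)))) * ENNReal.ofReal (Real.exp v) ^ n := by
    rw [← ENNReal.ofReal_pow (Real.exp_pos _).le, ← ENNReal.ofReal_mul (Real.exp_pos _).le,
      ← Real.exp_nat_mul, ← Real.exp_add]
    congr 2
    ring
  rw [e]
  refine (measure_mono hsub).trans ?_
  calc _ = ENNReal.ofReal (Real.exp (-(n * (l * x)))) * (ENNReal.ofReal (Real.exp (n * (l * x))) *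
        P {ω | ENNReal.ofReal (Real.exp (n * (l * x))) ≤
        ∏ k, ENNReal.ofReal (Real.exp (l * W k ω))}) := by
        rw [← mul_assoc (ENNReal.ofReal _), ← ENNReal.ofReal_mul (Real.exp_pos _).le,
          ← Real.exp_add]
        simp
    _ ≤ _ := by gcongr

end Chernoff

/-! ### Coordinates of a trajectory -/

section Trajectories

variable {X : Type u} {A : Type v} {H : ℕ}

theorem ctx_last_trunc (h : Fin H) (τ : Hist X A H) :
    ctx (trunc h.isLt.le τ) (Fin.last h) = ctx τ h.castSucc := by
  obtain ⟨k, hk⟩ := h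
  cases k <;> rfl

theorem ctx_succ (h : Fin H) (τ : Hist X A H) : ctx τ h.succ = (τ.2 h).2.2 := by
  simp [ctx]

/-- The history before level `h`, and what happens at level `h`. -/
def atLevel (h : Fin H) (τ : Hist X A H) : Hist X A h × (A × ℝ × X) :=
  (trunc h.isLt.le τ, τ.2 h)

variable [MeasurableSpace X] [MeasurableSpace A]

@[fun_prop]
theorem measurable_atLevel (h : Fin H) : Measurable (atLevel (X := X) (A := A) h) := by
  unfold atLevel
  fun_prop

@[fun_prop]
theorem measurable_ctx (j : Fin (H + 1)) : Measurable (fun τ : Hist X A H => ctx τ j) := by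
  refine Fin.cases ?_ (fun h => ?_) j
  · exact measurable_fst
  · simp_rw [ctx_succ]
    fun_prop

@[fun_prop]
theorem measurable_act (h : Fin H) : Measurable (fun τ : Hist X A H => act τ h) := by
  unfold act
  fun_prop

@[fun_prop]
theorem measurable_rew (h : Fin H) : Measurable (fun τ : Hist X A H => rew τ h) := by
  unfold rew
  fun_prop

end Trajectories

/-! ### Laws of episodes, level by level -/

section Processes

variable {X : Type u} {A : Type v} [MeasurableSpace X] [MeasurableSpace A] {H : ℕ}
  (C : CDP X A H)

/-- The law of what happens at level `h`, given the history before it. -/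
noncomputable def CDP.levelKernel (β : Behaviour X A) (h : ℕ) :
    Kernel (Hist X A h) (A × ℝ × X) :=
  β.act h ⊗ₖ C.step h

instance (β : Behaviour X A) (h : ℕ) : IsMarkovKernel (C.levelKernel β h) := by
  have := C.step_markov h
  have := β.act_markov h
  unfold CDP.levelKernel
  infer_instance

theorem CDP.law_map_atLevel (β : Behaviour X A) (h : Fin H) :
    (C.law β).map (atLevel h) = seqLaw C.init (C.levelKernel β) h ⊗ₘ C.levelKernel β h := by
  have := C.init_prob
  exact seqLaw_map_record C.init (C.levelKernel β) (fun _ => inferInstance) h.isLt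

/-- This is why arbitrary actions are harmless in the initial episodes: only the first context is
used there. -/
theorem CDP.law_map_ctx_zero (β : Behaviour X A) :
    (C.law β).map (fun τ => ctx τ 0) = C.init := by
  have := C.init_prob
  have e := seqLaw_map_trunc C.init (C.levelKernel β) (fun _ => inferInstance) H.zero_le
  have e' := congrArg (Measure.map Prod.fst) e
  rw [Measure.map_map measurable_fst (measurable_trunc _), seqLaw,
    Measure.map_map measurable_fst (by fun_prop)] at e'
  exact e'.trans Measure.map_id

variable [MeasurableSingletonClass A] [Finite A]

theorem CDP.ae_act_eq {β : Behaviour X A} {π : Policy X A} {h : Fin H}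
    (hβ : β.act h = π.kernel h) :
    ∀ᵐ τ ∂(C.law β), act τ h = π.1 (ctx τ h.castSucc) := by
  have := C.init_prob
  have := isProbabilityMeasure_seqLaw C.init (C.levelKernel β) (fun _ => inferInstance) h
  have := C.step_markov h
  have hm : MeasurableSet {q : Hist X A h × (A × ℝ × X) | q.2.1 = π.1 (ctx q.1 (Fin.last h))} :=
    measurableSet_eq_fun (by fun_prop) (π.2.comp ((measurable_ctx_last _).comp measurable_fst))
  have key : ∀ᵐ q ∂((C.law β).map (atLevel h)), q.2.1 = π.1 (ctx q.1 (Fin.last h)) := by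
    rw [C.law_map_atLevel, Measure.ae_compProd_iff hm]
    refine Filter.Eventually.of_forall fun ω => ?_
    have hm' : MeasurableSet {p : A × ℝ × X | p.1 = π.1 (ctx ω (Fin.last h))} :=
      measurableSet_eq_fun (by fun_prop) measurable_const
    unfold CDP.levelKernel
    rw [hβ, Kernel.ae_compProd_iff hm']
    unfold Policy.kernel
    rw [Kernel.deterministic_apply, ae_dirac_eq]
    simp
  filter_upwards [ae_of_ae_map (measurable_atLevel h).aemeasurable key] with τ hτ
  rw [← ctx_last_trunc]
  exact hτ

omit [MeasurableSingletonClass A] [Finite A] in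
theorem rollIn_self (π : Policy X A) (h : ℕ) : rollIn π π h = follow π := by
  simp [rollIn, follow]

end Processes

/-! ### Change of measure by importance weights -/

section ImportanceWeights

variable {X : Type u} {A : Type v} [MeasurableSpace X] [MeasurableSpace A]
  [MeasurableSingletonClass A] [Fintype A] [DecidableEq A] [Nonempty A] {H : ℕ} (C : CDP X A H)

/-- The importance weight `K 1[a_h = π(x_h)]`. -/
def impWeight (π : Policy X A) {h : ℕ} (q : Hist X A h × (A × ℝ × X)) : NNReal :=
  if q.2.1 = π.1 (ctx q.1 (Fin.last h)) then (Fintype.card A : NNReal) else 0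

omit [Nonempty A] in
@[fun_prop]
theorem measurable_impWeight (π : Policy X A) (h : ℕ) :
    Measurable (impWeight (X := X) (A := A) π (h := h)) :=
  Measurable.ite (measurableSet_eq_fun (by fun_prop)
    (π.2.comp ((measurable_ctx_last _).comp measurable_fst))) measurable_const measurable_const

/-- Before level `h` both behaviours follow `π`; at level `h` the uniform mass `1/K` times the
weight `K` leaves a unit mass at the action of `π'`. The later actions differ, so the identity is
confined to what `atLevel h` sees, up to and including the context after level `h`. -/
theorem CDP.withDensity_impWeight (π π' : Policy X A) (h : Fin H) :
    ((C.law (explore π h)).map (atLevel h)).withDensity (fun q => (impWeight π' q : ENNReal)) =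
      (C.law (rollIn π π' h)).map (atLevel h) := by
  have := C.init_prob
  have hs : seqLaw C.init (C.levelKernel (explore π h)) h =
      seqLaw C.init (C.levelKernel (rollIn π π' h)) h := by
    refine seqLaw_congr _ fun k hk => ?_
    simp [CDP.levelKernel, explore, rollIn, hk, hk.ne]
  have := C.step_markov h
  rw [C.law_map_atLevel, C.law_map_atLevel, hs]
  have := isProbabilityMeasure_seqLaw C.init (C.levelKernel (rollIn π π' h))
    (fun _ => inferInstance) h
  refine Measure.ext_of_lintegral _ fun G hG => ?_
  have hm : Measurable (fun q : Hist X A h × (A × ℝ × X) => (impWeight π' q : ENNReal)) := by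
    fun_prop
  rw [lintegral_withDensity_eq_lintegral_mul _ hm hG, Measure.lintegral_compProd (hm.mul hG),
    Measure.lintegral_compProd hG]
  refine lintegral_congr fun ω => ?_
  have e1 : C.levelKernel (explore π h) h =
      Kernel.const _ (PMF.uniformOfFintype A).toMeasure ⊗ₖ C.step h := by
    simp [CDP.levelKernel, explore]
  have e2 : C.levelKernel (rollIn π π' h) h = π'.kernel h ⊗ₖ C.step h := by
    simp [CDP.levelKernel, rollIn]
  rw [e1, e2, Kernel.lintegral_compProd _ _ _ (by fun_prop),
    Kernel.lintegral_compProd _ _ _ (by fun_prop), Kernel.const_apply, lintegral_fintype]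
  unfold Policy.kernel
  have hG' : Measurable fun a => ∫⁻ c, G (ω, a, c) ∂(C.step h) (ω, a) := measurable_of_finite _
  rw [Kernel.deterministic_apply, lintegral_dirac' _ hG',
    Finset.sum_eq_single (π'.1 (ctx ω (Fin.last h)))]
  · simp only [Pi.mul_apply, impWeight, if_true]
    rw [lintegral_const_mul _ (by fun_prop), PMF.toMeasure_apply_singleton _ _ (by simp),
      PMF.uniformOfFintype_apply, mul_comm, ← mul_assoc]
    simp [ENNReal.inv_mul_cancel]
  · intro a _ ha
    simp [impWeight, ha]
  · simp

theorem CDP.integral_impWeight (π π' : Policy X A) (h : Fin H)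
    {g : Hist X A h × (A × ℝ × X) → ℝ} (hg : Measurable g) :
    ∫ τ, (impWeight π' (atLevel h τ) : ℝ) * g (atLevel h τ) ∂(C.law (explore π h)) =
      ∫ τ, g (atLevel h τ) ∂(C.law (rollIn π π' h)) := by
  have hw : Measurable (fun q => (impWeight π' q : ℝ) * g q) := by fun_prop
  rw [← integral_map (measurable_atLevel h).aemeasurable hg.aestronglyMeasurable,
    ← C.withDensity_impWeight π π' h,
    integral_withDensity_eq_integral_smul (measurable_impWeight π' h)]
  exact (integral_map (measurable_atLevel h).aemeasurable hw.aestronglyMeasurable).symm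

end ImportanceWeights

/-! ### Bellman errors and the decomposition of the policy loss -/

section BellmanErrors

variable {X : Type u} {A : Type v} [MeasurableSpace X] [MeasurableSpace A]
  [MeasurableSingletonClass A] [Finite A] {H N : ℕ} (C : CDP X A H) (F : ValueClass X A N)

theorem ValueClass.measurable_val (i : Fin N) : Measurable (fun p : X × A => F.val i p.1 p.2) :=
  measurable_from_prod_countable_left fun a => F.val_measurable i a

theorem ValueClass.measurable_val_comp {Ω : Type*} [MeasurableSpace Ω] (i : Fin N) {f : Ω → X}
    {g : Ω → A} (hf : Measurable f) (hg : Measurable g) :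
    Measurable (fun ω => F.val i (f ω) (g ω)) :=
  (F.measurable_val i).comp (hf.prodMk hg)

/-- The residual of `f_i` at level `h`, when the next action is chosen by the greedy policy. -/
def stepResidual (i : Fin N) (h : Fin H) (q : Hist X A h × (A × ℝ × X)) : ℝ :=
  F.val i (ctx q.1 (Fin.last h)) q.2.1 - q.2.2.1
    - (if (h : ℕ) + 1 < H then F.val i q.2.2.2 ((F.greedy i).1 q.2.2.2) else 0)

omit [MeasurableSpace X] [MeasurableSpace A] [MeasurableSingletonClass A] [Finite A] in
theorem stepResidual_atLevel [MeasurableSpace X] [MeasurableSpace A] (F : ValueClass X A N)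
    (i : Fin N) (h : Fin H) (τ : Hist X A H) :
    stepResidual F i h (atLevel h τ) =
      F.val i (ctx τ h.castSucc) (act τ h) - rew τ h
      - (if (h : ℕ) + 1 < H
          then F.val i (ctx τ h.succ) ((F.greedy i).1 (ctx τ h.succ)) else 0) := by
  rw [ctx_succ, ← ctx_last_trunc]
  rfl

@[fun_prop]
theorem measurable_stepResidual (i : Fin N) (h : Fin H) :
    Measurable (stepResidual (X := X) (A := A) F i h) := by
  have h1 := F.measurable_val_comp i (f := fun q : Hist X A h × (A × ℝ × X) =>
    ctx q.1 (Fin.last h)) (g := fun q => q.2.1) (by fun_prop) (by fun_prop)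
  have h2 := F.measurable_val_comp i (f := fun q : Hist X A h × (A × ℝ × X) => q.2.2.2)
    (g := fun q => (F.greedy i).1 q.2.2.2) (by fun_prop) ((F.greedy i).2.comp (by fun_prop))
  unfold stepResidual
  split_ifs <;> fun_prop

@[fun_prop]
theorem measurable_residual (i : Fin N) (h : Fin H) :
    Measurable (residual (X := X) (A := A) F i h) := by
  have h1 := F.measurable_val_comp i (f := fun τ : Hist X A H => ctx τ h.castSucc)
    (g := fun τ => act τ h) (by fun_prop) (by fun_prop)
  unfold residual
  split_ifs with hh
  · have h2 := F.measurable_val_comp i (f := fun τ : Hist X A H => ctx τ h.succ)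
      (g := fun τ => act τ ⟨h + 1, hh⟩) (by fun_prop) (by fun_prop)
    fun_prop
  · fun_prop

theorem ae_residual_eq (i : Fin N) (π : Policy X A) (h : Fin H) :
    ∀ᵐ τ ∂(C.law (rollIn π (F.greedy i) h)),
      residual F i h τ = stepResidual F i h (atLevel h τ) := by
  by_cases hh : (h : ℕ) + 1 < H
  · have := C.ae_act_eq (β := rollIn π (F.greedy i) h) (π := F.greedy i) (h := ⟨h + 1, hh⟩)
      (by simp [rollIn])
    filter_upwards [this] with τ hτ
    rw [stepResidual_atLevel, residual, dif_pos hh, if_pos hh, hτ]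
    rfl
  · refine Filter.Eventually.of_forall fun τ => ?_
    rw [stepResidual_atLevel, residual, dif_neg hh, if_neg hh]

/-- The next action under the roll-in is almost surely the greedy one. Substituting it makes the
integrand a function of `atLevel h`, as the change of measure requires. -/
theorem bellmanError_eq (i : Fin N) (π : Policy X A) (h : Fin H) :
    bellmanError C F i π h =
      ∫ τ, stepResidual F i h (atLevel h τ) ∂(C.law (rollIn π (F.greedy i) h)) :=
  integral_congr_ae (ae_residual_eq C F i π h)

variable {C}

omit [MeasurableSingletonClass A] [Finite A] in
theorem CDP.BoundedRewards.rew_mem (hC : C.BoundedRewards) (β : Behaviour X A) :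
    ∀ᵐ τ ∂(C.law β), ∀ h, rew τ h ∈ Set.Icc (0 : ℝ) 1 := by
  filter_upwards [hC β] with τ hτ h
  exact ⟨hτ.1 h, (Finset.single_le_sum (fun h _ => hτ.1 h) (Finset.mem_univ h)).trans hτ.2⟩

omit [MeasurableSingletonClass A] [Finite A] in
theorem CDP.BoundedRewards.residual_mem (hC : C.BoundedRewards) (β : Behaviour X A) (i : Fin N)
    (h : Fin H) : ∀ᵐ τ ∂(C.law β), residual F i h τ ∈ Set.Icc (-2 : ℝ) 1 := by
  filter_upwards [hC.rew_mem β] with τ hτ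
  have h1 := hτ h
  have h2 := F.val_mem i (ctx τ h.castSucc) (act τ h)
  unfold residual
  split_ifs with hh
  · have h3 := F.val_mem i (ctx τ h.succ) (act τ ⟨h + 1, hh⟩)
    exact ⟨by linarith [h1.2, h2.1, h3.2], by linarith [h1.1, h2.2, h3.1]⟩
  · exact ⟨by linarith [h1.2, h2.1], by linarith [h1.1, h2.2]⟩

omit [MeasurableSingletonClass A] [Finite A] in
theorem CDP.BoundedRewards.stepResidual_mem (hC : C.BoundedRewards) (β : Behaviour X A)
    (i : Fin N) (h : Fin H) :
    ∀ᵐ τ ∂(C.law β), stepResidual F i h (atLevel h τ) ∈ Set.Icc (-2 : ℝ) 1 := by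
  filter_upwards [hC.rew_mem β] with τ hτ
  have h1 := hτ h
  have h2 := F.val_mem i (ctx τ h.castSucc) (act τ h)
  have h3 := F.val_mem i (ctx τ h.succ) ((F.greedy i).1 (ctx τ h.succ))
  rw [stepResidual_atLevel]
  split_ifs with hh
  · exact ⟨by linarith [h1.2, h2.1, h3.2], by linarith [h1.1, h2.2, h3.1]⟩
  · exact ⟨by linarith [h1.2, h2.1], by linarith [h1.1, h2.2]⟩

omit [MeasurableSingletonClass A] [Finite A] in
-- The values at consecutive levels telescope on every trajectory; no expectation is needed.
theorem sum_residual [NeZero H] (i : Fin N) (τ : Hist X A H) :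
    ∑ h, residual F i h τ = F.val i (ctx τ 0) (act τ 0) - ∑ h, rew τ h := by
  obtain ⟨n, rfl⟩ : ∃ n, H = n + 1 := ⟨H - 1, by have := NeZero.pos H; omega⟩
  simp only [residual, Finset.sum_sub_distrib]
  have e1 : ∑ h : Fin (n + 1), F.val i (ctx τ h.castSucc) (act τ h) =
      F.val i (ctx τ 0) (act τ 0) +
        ∑ h : Fin n, F.val i (ctx τ h.castSucc.succ) (act τ h.succ) := by
    rw [Fin.sum_univ_succ]
    rfl
  have e2 : ∑ h : Fin (n + 1), (if hh : (h : ℕ) + 1 < n + 1 then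
      F.val i (ctx τ h.succ) (act τ ⟨h + 1, hh⟩) else 0) =
        ∑ h : Fin n, F.val i (ctx τ h.castSucc.succ) (act τ h.succ) := by
    -- The last summand is the default value 0 at level `H + 1`.
    rw [Fin.sum_univ_castSucc]
    simp
    rfl
  rw [e1, e2]
  ring

/-- The value that `f_i` predicts for its own greedy policy. -/
noncomputable def predValue (C : CDP X A H) (F : ValueClass X A N) (i : Fin N) : ℝ :=
  ∫ x, F.val i x ((F.greedy i).1 x) ∂C.init

omit [MeasurableSpace X] [MeasurableSpace A] [MeasurableSingletonClass A] [Finite A] in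
theorem measurable_val_greedy [MeasurableSpace X] [MeasurableSpace A]
    [MeasurableSingletonClass A] [Finite A] (F : ValueClass X A N) (i : Fin N) :
    Measurable (fun x => F.val i x ((F.greedy i).1 x)) :=
  F.measurable_val_comp i measurable_id (F.greedy i).2

/-- Decomposition of the policy loss. -/
theorem predValue_sub_value (hH : 0 < H) (hC : C.BoundedRewards) (i : Fin N) :
    predValue C F i - C.value (F.greedy i) = ∑ h, bellmanError C F i (F.greedy i) h := by
  have : NeZero H := ⟨hH.ne'⟩
  -- With its own greedy policy as roll-in, all levels share one law, so the residuals can be summed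
  -- under the integral.
  have hb : ∀ h, bellmanError C F i (F.greedy i) h =
      ∫ τ, residual F i h τ ∂(C.law (follow (F.greedy i))) := fun h => by
    rw [bellmanError, rollIn_self]
  have hint : ∀ h, Integrable (residual F i h) (C.law (follow (F.greedy i))) := fun h =>
    Integrable.of_mem_Icc _ _ (measurable_residual F i h).aemeasurable
      (hC.residual_mem F _ i h)
  simp_rw [hb]
  rw [← integral_finsetSum _ fun h _ => hint h]
  simp_rw [sum_residual]
  have hr : Integrable (fun τ => ∑ h, rew τ h) (C.law (follow (F.greedy i))) :=
    integrable_finsetSum _ fun h _ => Integrable.of_mem_Icc 0 1 (by fun_prop)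
      ((hC.rew_mem _).mono fun τ hτ => hτ h)
  have h0 : ∫ τ, F.val i (ctx τ 0) (act τ 0) ∂(C.law (follow (F.greedy i))) =
      predValue C F i := by
    rw [predValue, ← C.law_map_ctx_zero (follow (F.greedy i)),
      integral_map (by fun_prop) (measurable_val_greedy F i).aestronglyMeasurable]
    refine integral_congr_ae ?_
    filter_upwards [C.ae_act_eq (β := follow (F.greedy i)) (π := F.greedy i) (h := 0) rfl]
      with τ hτ
    rw [hτ]
    rfl
  rw [integral_sub _ hr, h0]
  · rfl
  · exact Integrable.of_mem_Icc 0 1 (F.measurable_val_comp i (by fun_prop)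
      (by fun_prop)).aemeasurable (Filter.Eventually.of_forall fun τ => F.val_mem _ _ _)

end BellmanErrors

/-! ### Hoeffding and Bernstein type exponential moments -/

section Deviations

variable {Ω : Type*} [MeasurableSpace Ω]

theorem measure_abs_avg_sub_gt_le (P : Measure Ω) {n : ℕ} (hn : 0 < n) {W : Fin n → Ω → ℝ}
    (hW : ∀ k, Measurable (W k)) {l x v μ : ℝ} (hl : 0 ≤ l)
    (h : ∀ s : ℝ, |s| = l → ∫⁻ ω, ∏ k, ENNReal.ofReal (Real.exp (s * (W k ω - μ))) ∂P ≤
      ENNReal.ofReal (Real.exp v) ^ n) :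
    P {ω | x < |(1 / (n : ℝ)) * ∑ k, W k ω - μ|} ≤
      ENNReal.ofReal (2 * Real.exp (-(n * (l * x - v)))) := by
  have hn' : (n : ℝ) ≠ 0 := by positivity
  have h1 := measure_avg_ge_le P hn (W := fun k ω => W k ω - μ) (fun k => by fun_prop) (x := x)
    hl (h l (abs_of_nonneg hl))
  have h2 := measure_avg_ge_le P hn (W := fun k ω => -(W k ω - μ)) (fun k => by fun_prop)
    (x := x) (v := v) hl (by
      simpa only [mul_neg, neg_mul] using h (-l) (by rw [abs_neg, abs_of_nonneg hl]))
  have e1 : ∀ ω, (1 / (n : ℝ)) * ∑ k, (W k ω - μ) = (1 / (n : ℝ)) * ∑ k, W k ω - μ := by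
    intro ω
    simp only [Finset.sum_sub_distrib, Finset.sum_const, Finset.card_univ, Fintype.card_fin,
      nsmul_eq_mul]
    field_simp
  have e2 : ∀ ω, (1 / (n : ℝ)) * ∑ k, -(W k ω - μ) = -((1 / (n : ℝ)) * ∑ k, W k ω - μ) := by
    intro ω
    rw [Finset.sum_neg_distrib, mul_neg, e1]
  simp only [e1] at h1
  simp only [e2] at h2
  rw [two_mul, ENNReal.ofReal_add (Real.exp_pos _).le (Real.exp_pos _).le]
  refine (measure_mono ?_).trans ((measure_union_le _ _).trans (add_le_add h1 h2))
  intro ω hω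
  simp only [Set.mem_union, Set.mem_ofPred_eq] at hω ⊢
  exact (lt_abs.1 hω).imp le_of_lt le_of_lt

variable {P : Measure Ω} [IsProbabilityMeasure P] {Z : Ω → ℝ}

theorem lintegral_exp_le_of_mem_Icc {a b : ℝ} (hZ : Measurable Z)
    (h : ∀ᵐ ω ∂P, Z ω ∈ Set.Icc a b) (l : ℝ) :
    ∫⁻ ω, ENNReal.ofReal (Real.exp (l * (Z ω - ∫ ω, Z ω ∂P))) ∂P ≤
      ENNReal.ofReal (Real.exp (((b - a) / 2) ^ 2 * l ^ 2 / 2)) := by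
  have hs := hasSubgaussianMGF_of_mem_Icc hZ.aemeasurable h
  rw [← ofReal_integral_eq_lintegral_ofReal (hs.integrable_exp_mul l)
    (Filter.Eventually.of_forall fun _ => (Real.exp_pos _).le)]
  refine ENNReal.ofReal_le_ofReal ((hs.mgf_le l).trans (le_of_eq ?_))
  simp [div_pow]

/-- From `exp u ≤ 1 + u + u²` for `|u| ≤ 1`, integrated, and `1 + x ≤ exp x`. The range `b` only
limits `l`; the exponent sees the second moment. -/
theorem lintegral_exp_le_of_sq_le {b s : ℝ} (hZ : Measurable Z)
    (h : ∀ᵐ ω ∂P, |Z ω| ≤ b) (hs : ∫ ω, Z ω ^ 2 ∂P ≤ s) {l : ℝ} (hl : |l| * b ≤ 1) :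
    ∫⁻ ω, ENNReal.ofReal (Real.exp (l * (Z ω - ∫ ω, Z ω ∂P))) ∂P ≤
      ENNReal.ofReal (Real.exp (s * l ^ 2)) := by
  have hi : Integrable Z P := Integrable.of_mem_Icc (-b) b hZ.aemeasurable
    (h.mono fun ω hω => abs_le.1 hω)
  have hi2 : Integrable (fun ω => Z ω ^ 2) P := Integrable.of_mem_Icc 0 (b ^ 2) (by fun_prop)
    (h.mono fun ω hω => ⟨sq_nonneg _, sq_le_sq' (abs_le.1 hω).1 (abs_le.1 hω).2⟩)
  have hle : ∀ᵐ ω ∂P, Real.exp (l * Z ω) ≤ 1 + l * Z ω + l ^ 2 * Z ω ^ 2 := by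
    filter_upwards [h] with ω hω
    have h1 : |l * Z ω| ≤ 1 := by
      rw [abs_mul]
      exact (mul_le_mul_of_nonneg_left hω (abs_nonneg _)).trans hl
    have h2 := (abs_le.1 (Real.abs_exp_sub_one_sub_id_le h1)).2
    rw [← mul_pow]
    linarith
  set μ := ∫ ω, Z ω ∂P
  have hub : Integrable (fun ω => 1 + l * Z ω + l ^ 2 * Z ω ^ 2) P := by fun_prop
  calc ∫⁻ ω, ENNReal.ofReal (Real.exp (l * (Z ω - μ))) ∂P
      ≤ ∫⁻ ω, ENNReal.ofReal (Real.exp (-(l * μ)) * (1 + l * Z ω + l ^ 2 * Z ω ^ 2)) ∂P := by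
        refine lintegral_mono_ae (hle.mono fun ω hω => ENNReal.ofReal_le_ofReal ?_)
        rw [show l * (Z ω - μ) = -(l * μ) + l * Z ω by ring, Real.exp_add]
        exact mul_le_mul_of_nonneg_left hω (Real.exp_pos _).le
    _ = ENNReal.ofReal (∫ ω, Real.exp (-(l * μ)) * (1 + l * Z ω + l ^ 2 * Z ω ^ 2) ∂P) := by
        refine (ofReal_integral_eq_lintegral_ofReal (hub.const_mul _) ?_).symm
        filter_upwards [hle] with ω hω
        exact mul_nonneg (Real.exp_pos _).le ((Real.exp_pos _).le.trans hω)
    _ ≤ ENNReal.ofReal (Real.exp (s * l ^ 2)) := by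
        refine ENNReal.ofReal_le_ofReal ?_
        rw [integral_const_mul, integral_add (by fun_prop) (by fun_prop),
          integral_add (by fun_prop) (by fun_prop), integral_const_mul, integral_const_mul]
        simp only [integral_const, probReal_univ, smul_eq_mul, mul_one]
        calc _ ≤ Real.exp (-(l * μ)) * Real.exp (l * μ + s * l ^ 2) := by
              refine mul_le_mul_of_nonneg_left ?_ (Real.exp_pos _).le
              have := Real.add_one_le_exp (l * μ + s * l ^ 2)
              nlinarith [sq_nonneg l]
          _ = _ := by rw [← Real.exp_add]; ring_nf

end Deviations

/-! ### Accuracy of the three empirical estimates -/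

section Estimates

variable {X : Type u} {A : Type v} [MeasurableSpace X] [MeasurableSpace A]
  [MeasurableSingletonClass A] {H N : ℕ} {C : CDP X A H}

omit [MeasurableSingletonClass A] in
theorem start_markov {start : (k : ℕ) → Kernel (Unit × (Fin k → Hist X A H)) (Hist X A H)}
    (h : ∀ k ω, ∃ β : Behaviour X A, start k ω = C.law β) (k : ℕ) : IsMarkovKernel (start k) := by
  refine ⟨fun ω => ?_⟩
  obtain ⟨β, hβ⟩ := h k ω
  rw [hβ]
  infer_instance

theorem empValue_deviation [Finite A] (F : ValueClass X A N) (i : Fin N)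
    {start : (k : ℕ) → Kernel (Unit × (Fin k → Hist X A H)) (Hist X A H)}
    (h : ∀ k ω, ∃ β : Behaviour X A, start k ω = C.law β) {n : ℕ} (hn : 0 < n) {x : ℝ}
    (hx : 0 ≤ x) :
    (seqLaw (Measure.dirac ()) start n).map Prod.snd
        {d | x < |empValue F d i - predValue C F i|} ≤
      ENNReal.ofReal (2 * Real.exp (-(n * (2 * x ^ 2)))) := by
  have := C.init_prob
  have hg := measurable_val_greedy F i
  have hmu : ∀ s, Measurable fun y => ENNReal.ofReal
      (Real.exp (s * (F.val i y ((F.greedy i).1 y) - predValue C F i))) := by fun_prop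
  -- For range 1 the exponent is `l * x - l² / 8`, maximal at `l = 4 * x`.
  have key := measure_abs_avg_sub_gt_le
    ((seqLaw (Measure.dirac ()) start n).map Prod.snd) hn
    (W := fun k d => F.val i (ctx (d k) 0) ((F.greedy i).1 (ctx (d k) 0)))
    (fun k => hg.comp (by fun_prop)) (l := 4 * x) (x := x) (v := 2 * x ^ 2)
    (μ := predValue C F i) (by positivity) ?_
  · refine le_trans key (le_of_eq ?_)
    ring_nf
  intro s hs
  set G : Hist X A H → ENNReal := fun τ => ENNReal.ofReal (Real.exp
      (s * (F.val i (ctx τ 0) ((F.greedy i).1 (ctx τ 0)) - predValue C F i))) with hG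
  have hGm : Measurable G := (hmu s).comp (measurable_ctx 0)
  have e0 := lintegral_map (μ := seqLaw (Measure.dirac ()) start n)
    (f := fun d : Fin n → Hist X A H => ∏ k, G (d k)) (by fun_prop) measurable_snd
  refine e0.le.trans (lintegral_prod_seqLaw_le (Measure.dirac ()) start (start_markov h) hGm
    (fun k ω => ?_) n)
  obtain ⟨β, hβ⟩ := h k ω
  rw [hβ]
  have e := lintegral_map (μ := C.law β) (hmu s) (measurable_ctx 0)
  rw [C.law_map_ctx_zero] at e
  refine e.ge.trans ((lintegral_exp_le_of_mem_Icc hg (Filter.Eventually.of_forall fun y =>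
    F.val_mem i y _) s).trans (le_of_eq ?_))
  rw [← sq_abs s, hs]
  ring_nf

theorem empOwnError_deviation [Finite A] (F : ValueClass X A N) (hC : C.BoundedRewards)
    (i : Fin N) (h : Fin H) {n : ℕ} (hn : 0 < n) {x : ℝ} (hx : 0 ≤ x) :
    evalKernel C F n i {d | x < |empOwnError F d i h - bellmanError C F i (F.greedy i) h|} ≤
      ENNReal.ofReal (2 * Real.exp (-(n * (2 * x ^ 2 / 9)))) := by
  change Measure.pi (fun _ => C.law (follow (F.greedy i))) _ ≤ _
  -- The residual has range 3, so the exponent is `l * x - 9 * l² / 8`, maximal at `l = 4 * x / 9`.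
  have key := measure_abs_avg_sub_gt_le
    (Measure.pi (fun _ : Fin n => C.law (follow (F.greedy i)))) hn
    (W := fun k d => residual F i h (d k)) (fun k => by fun_prop) (l := 4 * x / 9) (x := x)
    (v := 2 * x ^ 2 / 9) (μ := bellmanError C F i (F.greedy i) h) (by positivity) ?_
  · refine le_trans key (le_of_eq ?_)
    ring_nf
  intro s hs
  have hm := measurable_residual F i h
  rw [lintegral_prod_pi _ (G := fun τ => ENNReal.ofReal (Real.exp (s * (residual F i h τ -
    bellmanError C F i (F.greedy i) h)))) (by fun_prop)]
  refine pow_le_pow_left' ?_ n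
  have e : bellmanError C F i (F.greedy i) h =
      ∫ τ, residual F i h τ ∂(C.law (follow (F.greedy i))) := by
    rw [bellmanError, rollIn_self]
  rw [e]
  refine (lintegral_exp_le_of_mem_Icc hm (hC.residual_mem F _ i h) s).trans (le_of_eq ?_)
  rw [← sq_abs s, hs]
  ring_nf

omit [MeasurableSingletonClass A] in
theorem empError_eq [Fintype A] [DecidableEq A] (F : ValueClass X A N) {n : ℕ}
    (d : Fin n → Hist X A H) (i : Fin N) (h : Fin H) :
    empError F d i h = (1 / (n : ℝ)) * ∑ k, (impWeight (F.greedy i) (atLevel h (d k)) : ℝ) *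
      stepResidual F i h (atLevel h (d k)) := by
  unfold empError
  congr 1
  refine Finset.sum_congr rfl fun k _ => ?_
  rw [stepResidual_atLevel, impWeight]
  congr 1
  simp only [atLevel, ctx_last_trunc]
  change _ = ((if act (d k) h = (F.greedy i).1 (ctx (d k) h.castSucc) then
    (Fintype.card A : NNReal) else 0 : NNReal) : ℝ)
  split_ifs <;> simp

theorem empError_deviation [Fintype A] [DecidableEq A] [Nonempty A] (F : ValueClass X A N)
    (hC : C.BoundedRewards) (i j : Fin N) (h : Fin H) {n : ℕ} (hn : 0 < n) {x : ℝ}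
    (hx : 0 ≤ x) (hx1 : x ≤ 4) :
    exploreKernel C F n (j, h)
        {d | x < |empError F d i h - bellmanError C F i (F.greedy j) h|} ≤
      ENNReal.ofReal (2 * Real.exp (-(n * (x ^ 2 / (16 * Fintype.card A))))) := by
  change Measure.pi (fun _ => C.law (explore (F.greedy j) h)) _ ≤ _
  have hK : (0 : ℝ) < Fintype.card A := by exact_mod_cast Fintype.card_pos
  set K : ℝ := (Fintype.card A : ℝ) with hKdef
  set P := C.law (explore (F.greedy j) h) with hP
  set Z : Hist X A H → ℝ := fun τ => (impWeight (F.greedy i) (atLevel h τ) : ℝ) *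
      stepResidual F i h (atLevel h τ) with hZ
  have hZm : Measurable Z := by fun_prop
  have hμ : bellmanError C F i (F.greedy j) h = ∫ τ, Z τ ∂P := by
    rw [bellmanError_eq, hZ, hP, C.integral_impWeight _ _ h (measurable_stepResidual F i h)]
  have hw : ∀ τ, (impWeight (F.greedy i) (atLevel h τ) : ℝ) = K ∨
      (impWeight (F.greedy i) (atLevel h τ) : ℝ) = 0 := by
    intro τ
    unfold impWeight
    split_ifs <;> simp [hKdef]
  have hres : ∀ᵐ τ ∂P, |stepResidual F i h (atLevel h τ)| ≤ 2 := by
    filter_upwards [hC.stepResidual_mem F (explore (F.greedy j) h) i h] with τ hτ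
    exact abs_le.2 ⟨hτ.1, hτ.2.trans (by norm_num)⟩
  have hZb : ∀ᵐ τ ∂P, |Z τ| ≤ 2 * K := by
    filter_upwards [hres] with τ hτ
    rw [hZ, abs_mul]
    rcases hw τ with e | e <;> rw [e]
    · rw [abs_of_pos hK]
      nlinarith
    · simp only [abs_zero, zero_mul]
      positivity
  -- The change of measure applied to the constant 1.
  have hw1 : ∫ τ, (impWeight (F.greedy i) (atLevel h τ) : ℝ) ∂P = 1 := by
    have := C.integral_impWeight (F.greedy j) (F.greedy i) h (g := fun _ => 1) measurable_const
    simpa using this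
  have hwi : Integrable (fun τ => (impWeight (F.greedy i) (atLevel h τ) : ℝ)) P := by
    refine Integrable.of_mem_Icc 0 K (by fun_prop) (Filter.Eventually.of_forall fun τ => ?_)
    rcases hw τ with e | e <;> rw [e]
    · exact ⟨hK.le, le_rfl⟩
    · exact ⟨le_rfl, hK.le⟩
  -- The weight takes only the values 0 and `K`, so its square is `K` times itself; its mean is 1,
  -- which saves a factor `K`.
  have hZ2 : ∫ τ, Z τ ^ 2 ∂P ≤ 4 * K := by
    calc ∫ τ, Z τ ^ 2 ∂P
        ≤ ∫ τ, 4 * K * (impWeight (F.greedy i) (atLevel h τ) : ℝ) ∂P := by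
          refine integral_mono_of_nonneg (Filter.Eventually.of_forall fun τ => sq_nonneg _)
            (hwi.const_mul _) ?_
          filter_upwards [hres] with τ hτ
          have h4 : stepResidual F i h (atLevel h τ) ^ 2 ≤ 4 := by
            have := sq_le_sq' (abs_le.1 hτ).1 (abs_le.1 hτ).2
            linarith
          rw [hZ, mul_pow]
          rcases hw τ with e | e <;> rw [e]
          · nlinarith [sq_nonneg K]
          · simp
      _ = 4 * K := by rw [integral_const_mul, hw1, mul_one]
  -- This `l` maximizes `l * x - 4 * K * l²`; the requirement `l * (2 * K) ≤ 1` becomes `x ≤ 4`.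
  have key := measure_abs_avg_sub_gt_le (Measure.pi (fun _ : Fin n => P)) hn
    (W := fun k d => Z (d k)) (fun k => by fun_prop) (l := x / (8 * K)) (x := x)
    (v := 4 * K * (x / (8 * K)) ^ 2) (μ := ∫ τ, Z τ ∂P) (by positivity) ?_
  · simp_rw [empError_eq, hμ]
    convert key using 5
    field_simp
    ring
  intro s hs
  rw [lintegral_prod_pi _ (G := fun τ => ENNReal.ofReal (Real.exp (s * (Z τ - ∫ τ, Z τ ∂P))))
    (by fun_prop)]
  refine pow_le_pow_left' ?_ n
  rw [← hs, sq_abs]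
  refine lintegral_exp_le_of_sq_le hZm hZb hZ2 ?_
  rw [hs]
  calc x / (8 * K) * (2 * K) = x / 4 := by field_simp; ring
    _ ≤ 1 := by linarith

end Estimates

/-! ### The ellipsoid argument: few deep cuts -/

section Ellipsoids

open Matrix

variable {M : ℕ}

/-- Cauchy-Schwarz for the inner product of `A`, obtained from nonnegativity of the form at `ξ - p⁻¹
• A⁻¹ν`. It turns a point of the ellipsoid that violates a constraint strongly into a lower bound on
`ν ⬝ᵥ A⁻¹ *ᵥ ν`. -/
theorem sq_dotProduct_le_dotProduct_inv_mulVec {A : Matrix (Fin M) (Fin M) ℝ} (hA : A.PosDef)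
    {ν ξ : Fin M → ℝ} (hξ : ξ ⬝ᵥ A *ᵥ ξ ≤ 1) : (ν ⬝ᵥ ξ) ^ 2 ≤ ν ⬝ᵥ A⁻¹ *ᵥ ν := by
  set p := ν ⬝ᵥ ξ with hp
  set w := A⁻¹ *ᵥ ν with hw
  have hAw : A *ᵥ w = ν := by
    rw [hw, mulVec_mulVec, mul_nonsing_inv _ (A.isUnit_iff_isUnit_det.1 hA.isUnit), one_mulVec]
  have hq : 0 ≤ w ⬝ᵥ A *ᵥ w := by simpa using hA.posSemidef.dotProduct_mulVec_nonneg w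
  rw [hAw, dotProduct_comm] at hq
  by_cases h0 : p = 0
  · rw [h0]
    simpa using hq
  have hsym : w ⬝ᵥ A *ᵥ ξ = p := by
    have hT : Aᵀ = A := by simpa using hA.isHermitian.eq
    rw [dotProduct_mulVec, ← mulVec_transpose, hT, hAw]
  have key : 0 ≤ (ξ - p⁻¹ • w) ⬝ᵥ A *ᵥ (ξ - p⁻¹ • w) := by
    simpa using hA.posSemidef.dotProduct_mulVec_nonneg (ξ - p⁻¹ • w)
  have e : (ξ - p⁻¹ • w) ⬝ᵥ A *ᵥ (ξ - p⁻¹ • w) =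
      ξ ⬝ᵥ A *ᵥ ξ - 2 + (p ^ 2)⁻¹ * (ν ⬝ᵥ w) := by
    rw [mulVec_sub, mulVec_smul, hAw]
    simp only [sub_dotProduct, dotProduct_sub, smul_dotProduct, dotProduct_smul, smul_eq_mul,
      hsym, dotProduct_comm ξ ν, ← hp, dotProduct_comm w ν]
    field_simp
    ring
  rw [e] at key
  have hp2 : 0 < p ^ 2 := by positivity
  have h1 : 1 ≤ (p ^ 2)⁻¹ * (ν ⬝ᵥ w) := by linarith
  rwa [← div_eq_inv_mul, le_div_iff₀ hp2, one_mul] at h1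

/-- The matrix determinant lemma for a rank-one update. -/
theorem det_smul_add_vecMulVec {A : Matrix (Fin M) (Fin M) ℝ} (hA : A.PosDef) (hM : 0 < M)
    {r : ℝ} (hr : 0 < r) (c : ℝ) (ν : Fin M → ℝ) :
    (r • A + c • vecMulVec ν ν).det = r ^ (M - 1) * A.det * (r + c * (ν ⬝ᵥ A⁻¹ *ᵥ ν)) := by
  have hu : IsUnit A.det := A.isUnit_iff_isUnit_det.1 hA.isUnit
  have hdet : (r • A).det = r ^ M * A.det := by simp
  have hu' : IsUnit (r • A).det := by
    rw [hdet]
    exact (IsUnit.mk0 _ (by positivity)).mul hu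
  have e : c • vecMulVec ν ν = replicateCol Unit (c • ν) * replicateRow Unit ν := by
    rw [← vecMulVec_eq, smul_vecMulVec]
  have hinv : (r • A)⁻¹ = r⁻¹ • A⁻¹ := by
    refine inv_eq_left_inv ?_
    rw [smul_mul_smul_comm, inv_mul_cancel₀ hr.ne', nonsing_inv_mul _ hu, one_smul]
  rw [e, det_add_replicateCol_mul_replicateRow hu', hdet, hinv]
  have e2 : (1 + replicateRow Unit ν * (r⁻¹ • A⁻¹) * replicateCol Unit (c • ν)).det =
      1 + r⁻¹ * c * (ν ⬝ᵥ A⁻¹ *ᵥ ν) := by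
    rw [det_unique]
    simp [Matrix.mul_assoc, Matrix.mul_apply, dotProduct, mulVec, Finset.mul_sum]
    refine Finset.sum_congr rfl fun i _ => Finset.sum_congr rfl fun j _ => ?_
    ring
  rw [e2]
  obtain ⟨k, rfl⟩ : ∃ k, M = k + 1 := ⟨M - 1, by omega⟩
  simp only [Nat.add_sub_cancel]
  field_simp
  ring

/-- AM-GM for the eigenvalues. -/
theorem det_le_trace_div_pow {A : Matrix (Fin M) (Fin M) ℝ} (hA : A.PosDef) (hM : 0 < M) :
    A.det ≤ (A.trace / M) ^ M := by
  have hM' : (0 : ℝ) < M := by exact_mod_cast hM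
  have h0 : ∀ i, 0 ≤ hA.isHermitian.eigenvalues i := fun i => (hA.eigenvalues_pos i).le
  have key := Real.geom_mean_le_arith_mean Finset.univ (fun _ : Fin M => (1 : ℝ))
    hA.isHermitian.eigenvalues (fun _ _ => zero_le_one) (by simpa using hM) (fun i _ => h0 i)
  have hd : A.det = ∏ i, hA.isHermitian.eigenvalues i := by
    simpa using hA.isHermitian.det_eq_prod_eigenvalues
  have ht : A.trace = ∑ i, hA.isHermitian.eigenvalues i := by
    simpa using hA.isHermitian.trace_eq_sum_eigenvalues
  simp only [Real.rpow_one, Finset.sum_const, Finset.card_univ, Fintype.card_fin, nsmul_eq_mul,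
    mul_one, one_mul, ← hd, ← ht] at key
  have hdn : 0 ≤ A.det := hA.det_pos.le
  calc A.det = (A.det ^ ((M : ℝ)⁻¹)) ^ M := (Real.rpow_inv_natCast_pow hdn hM.ne').symm
    _ ≤ _ := pow_le_pow_left₀ (by positivity) key M

/-- Shrinking ellipsoids `{ξ | ξ ⬝ᵥ A *ᵥ ξ ≤ 1}` that contain the points of a ball which satisfy
the constraints `|ν_s ⬝ᵥ ξ| ≤ γ`, if each new constraint cuts off a point `ξ_t` deeply. -/
theorem exists_ellipsoid {ι : Type*} [LinearOrder ι] (hM : 0 < M) {γ D τ : ℝ} (hγ : 0 < γ)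
    (hD : 0 < D) (hτ : M / D ^ 2 ≤ τ) (ν ξ : ι → Fin M → ℝ) (S : Finset ι)
    (hξ : ∀ t ∈ S, ξ t ⬝ᵥ ξ t ≤ D ^ 2) (hν : ∀ t ∈ S, ν t ⬝ᵥ ν t ≤ τ * γ ^ 2)
    (hlt : ∀ s ∈ S, ∀ t ∈ S, s < t → (ν s ⬝ᵥ ξ t) ^ 2 ≤ γ ^ 2)
    (heq : ∀ t ∈ S, 9 * M * γ ^ 2 ≤ (ν t ⬝ᵥ ξ t) ^ 2) :
    ∃ A : Matrix (Fin M) (Fin M) ℝ, A.PosDef ∧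
      (8 * (1 - 7 / (8 * M) : ℝ) ^ (M - 1)) ^ S.card * (D ^ (2 * M))⁻¹ ≤ A.det ∧ A.trace ≤ τ ∧
      ∀ x : Fin M → ℝ, x ⬝ᵥ x ≤ D ^ 2 → (∀ s ∈ S, (ν s ⬝ᵥ x) ^ 2 ≤ γ ^ 2) →
        x ⬝ᵥ A *ᵥ x ≤ 1 := by
  have hM1 : (1 : ℝ) ≤ M := by exact_mod_cast hM
  induction S using Finset.induction_on_max with
  | empty =>
    -- Start from the ball of radius `D`.
    refine ⟨(D ^ 2)⁻¹ • 1, PosDef.one.smul (by positivity), ?_, ?_, fun x hx _ => ?_⟩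
    · simp [pow_mul]
    · simpa [trace_smul, div_eq_inv_mul] using hτ
    · rw [smul_mulVec, one_mulVec, dotProduct_smul, smul_eq_mul, ← div_eq_inv_mul]
      exact div_le_one_of_le₀ hx (by positivity)
  | insert a S ha ih =>
    obtain ⟨A, hA, hdet, htr, hsub⟩ := ih (fun t ht => hξ t (Finset.mem_insert_of_mem ht))
      (fun t ht => hν t (Finset.mem_insert_of_mem ht))
      (fun s hs t ht => hlt s (Finset.mem_insert_of_mem hs) t (Finset.mem_insert_of_mem ht))
      (fun t ht => heq t (Finset.mem_insert_of_mem ht))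
    have haS : a ∉ S := fun h => lt_irrefl _ (ha a h)
    have hmem := Finset.mem_insert_self a S
    -- With this weight the determinant gains `1 - s + 9 * M * s ≥ 1/8 + 63/8 = 8` in the direction
    -- of the cut and loses only `(1 - s) ^ (M - 1)` in the others.
    set s : ℝ := 7 / (8 * M) with hs
    have hs0 : 0 < s := by positivity
    have hs1 : s ≤ 7 / 8 := by
      rw [hs, div_le_div_iff₀ (by positivity) (by norm_num)]
      linarith
    have hsM : s * M = 7 / 8 := by
      rw [hs]
      field_simp
    have hr : 0 < 1 - s := by linarith
    have hrank : (vecMulVec (ν a) (ν a)).PosSemidef := by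
      simpa using posSemidef_vecMulVec_self_star (ν a)
    -- A convex combination of the forms of the old ellipsoid and of the slab `|ν_a ⬝ᵥ x| ≤ γ` is at
    -- most 1 on their intersection; the trace bound is preserved by convexity as well.
    refine ⟨(1 - s) • A + (s / γ ^ 2) • vecMulVec (ν a) (ν a),
      (hA.smul hr).add_posSemidef (hrank.smul (by positivity)), ?_, ?_, fun x hx hxS => ?_⟩
    · have hin : ξ a ⬝ᵥ A *ᵥ ξ a ≤ 1 := hsub _ (hξ a hmem) fun t ht =>
        hlt t (Finset.mem_insert_of_mem ht) a hmem (ha t ht)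
      have hq := (heq a hmem).trans (sq_dotProduct_le_dotProduct_inv_mulVec (ν := ν a) hA hin)
      have h8 : 8 ≤ 1 - s + s / γ ^ 2 * (ν a ⬝ᵥ A⁻¹ *ᵥ ν a) := by
        have : s / γ ^ 2 * (9 * M * γ ^ 2) ≤ s / γ ^ 2 * (ν a ⬝ᵥ A⁻¹ *ᵥ ν a) :=
          mul_le_mul_of_nonneg_left hq (by positivity)
        have e : s / γ ^ 2 * (9 * M * γ ^ 2) = 63 / 8 := by
          rw [show s / γ ^ 2 * (9 * M * γ ^ 2) = 9 * (s * M) by field_simp, hsM]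
          norm_num
        linarith
      rw [Finset.card_insert_of_notMem haS, det_smul_add_vecMulVec hA hM hr, pow_succ]
      have hdp := hA.det_pos
      calc _ = (1 - s) ^ (M - 1) *
            ((8 * (1 - s) ^ (M - 1)) ^ S.card * (D ^ (2 * M))⁻¹) * 8 := by ring
        _ ≤ (1 - s) ^ (M - 1) * A.det * 8 := by gcongr
        _ ≤ _ := by gcongr
    · rw [trace_add, trace_smul, trace_smul, trace_vecMulVec, smul_eq_mul, smul_eq_mul]
      have h1 : s / γ ^ 2 * (ν a ⬝ᵥ ν a) ≤ s / γ ^ 2 * (τ * γ ^ 2) :=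
        mul_le_mul_of_nonneg_left (hν a hmem) (by positivity)
      have e : s / γ ^ 2 * (τ * γ ^ 2) = s * τ := by field_simp
      nlinarith
    · have h1 := hsub x hx fun t ht => hxS t (Finset.mem_insert_of_mem ht)
      have h2 := hxS a hmem
      have e : x ⬝ᵥ ((1 - s) • A + (s / γ ^ 2) • vecMulVec (ν a) (ν a)) *ᵥ x =
          (1 - s) * (x ⬝ᵥ A *ᵥ x) + s / γ ^ 2 * (ν a ⬝ᵥ x) ^ 2 := by
        rw [add_mulVec, smul_mulVec, smul_mulVec, dotProduct_add, dotProduct_smul,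
          dotProduct_smul, vecMulVec_mulVec]
        simp [dotProduct_comm x (ν a), sq]
      rw [e]
      have h3 : s / γ ^ 2 * (ν a ⬝ᵥ x) ^ 2 ≤ s / γ ^ 2 * γ ^ 2 :=
        mul_le_mul_of_nonneg_left h2 (by positivity)
      have e3 : s / γ ^ 2 * γ ^ 2 = s := by field_simp
      nlinarith

/-- Follows from `1 - 1/x ≤ log x`. A cut thus raises the logarithm of the determinant by at least
`log 8 - 7/8 > 1`. -/
theorem neg_le_mul_log_one_sub (hM : 0 < M) :
    -(7 / 8 : ℝ) ≤ ((M - 1 : ℕ) : ℝ) * Real.log (1 - 7 / (8 * M)) := by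
  have hM1 : (1 : ℝ) ≤ M := by exact_mod_cast hM
  have hp : (0 : ℝ) < 8 * M - 7 := by linarith
  have e : (1 - 7 / (8 * M) : ℝ) = (8 * M - 7) / (8 * M) := by field_simp
  have h1 := Real.one_sub_inv_le_log_of_pos (x := (1 - 7 / (8 * M) : ℝ)) (by rw [e]; positivity)
  have e2 : (1 : ℝ) - (1 - 7 / (8 * M) : ℝ)⁻¹ = -(7 / (8 * M - 7)) := by
    rw [e]
    field_simp
    ring
  rw [e2] at h1
  rw [Nat.cast_sub hM, Nat.cast_one]
  have h2 : (M - 1 : ℝ) * (7 / (8 * M - 7)) ≤ 7 / 8 := by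
    rw [← mul_div_assoc, div_le_div_iff₀ hp (by norm_num)]
    linarith
  nlinarith

/-- The number of deep cuts is bounded. -/
theorem card_le_of_deep_cuts {ι : Type*} [LinearOrder ι] (hM : 0 < M) {γ ζ : ℝ} (hγ : 0 < γ)
    (hL : 1 ≤ Real.log (ζ / γ)) (hζ : 0 < ζ) (ν ξ : ι → EuclideanSpace ℝ (Fin M)) (S : Finset ι)
    (hnorm : ∀ s ∈ S, ∀ t ∈ S, ‖ν s‖ * ‖ξ t‖ ≤ ζ)
    (hlt : ∀ s ∈ S, ∀ t ∈ S, s < t → |⟪ν s, ξ t⟫| ≤ γ)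
    (heq : ∀ t ∈ S, 3 * √M * γ ≤ |⟪ν t, ξ t⟫|) :
    (S.card : ℝ) ≤ 2 * M * Real.log (ζ / γ) - 1 := by
  have hM1 : (1 : ℝ) ≤ M := by exact_mod_cast hM
  set L := Real.log (ζ / γ) with hLdef
  rcases S.eq_empty_or_nonempty with rfl | hS
  · simp only [Finset.card_empty, Nat.cast_zero]
    nlinarith
  obtain ⟨b, hb, hbmax⟩ := S.exists_max_image (fun t => ‖ξ t‖) hS
  have hip : ∀ x y : EuclideanSpace ℝ (Fin M), ⟪x, y⟫ = x.ofLp ⬝ᵥ y.ofLp := fun x y => by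
    rw [EuclideanSpace.inner_eq_star_dotProduct, dotProduct_comm]
    simp
  have hnn : ∀ x : EuclideanSpace ℝ (Fin M), x.ofLp ⬝ᵥ x.ofLp = ‖x‖ ^ 2 := fun x => by
    rw [← hip, real_inner_self_eq_norm_sq]
  have hD : 0 < ‖ξ b‖ := by
    have h1 := heq b hb
    have h2 : 0 < 3 * √M * γ := by positivity
    refine norm_pos_iff.2 fun h0 => ?_
    rw [h0, inner_zero_right, abs_zero] at h1
    linarith
  set D := ‖ξ b‖
  -- The norms are bounded only through products. As `D` is the largest norm of a `ξ t`, every `‖ν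
  -- t‖` is at most `ζ / D`, and `D` cancels between trace and determinant.
  set τ := max (M / D ^ 2) ((ζ / γ) ^ 2 / D ^ 2)
  obtain ⟨A, hA, hdet, htr, -⟩ := exists_ellipsoid hM hγ hD (le_max_left _ _ : _ ≤ τ)
    (fun t => (ν t).ofLp) (fun t => (ξ t).ofLp) S
    (fun t ht => by rw [hnn]; exact pow_le_pow_left₀ (norm_nonneg _) (hbmax t ht) 2)
    (fun t ht => by
      rw [hnn]
      have h1 : ‖ν t‖ ^ 2 * D ^ 2 ≤ ζ ^ 2 := by
        rw [← mul_pow]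
        exact pow_le_pow_left₀ (by positivity) (hnorm t ht b hb) 2
      calc ‖ν t‖ ^ 2 ≤ ζ ^ 2 / D ^ 2 := by rwa [le_div_iff₀ (by positivity)]
        _ = (ζ / γ) ^ 2 / D ^ 2 * γ ^ 2 := by field_simp
        _ ≤ τ * γ ^ 2 := by gcongr; exact le_max_right _ _)
    (fun s hs t ht hst => by
      rw [← hip, ← sq_abs ⟪_, _⟫]
      exact pow_le_pow_left₀ (abs_nonneg _) (hlt s hs t ht hst) 2)
    (fun t ht => by
      rw [← hip, ← sq_abs ⟪_, _⟫]
      calc (9 * M * γ ^ 2 : ℝ) = (3 * √M * γ) ^ 2 := by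
            rw [mul_pow, mul_pow, Real.sq_sqrt (by positivity)]
            norm_num
        _ ≤ _ := pow_le_pow_left₀ (by positivity) (heq t ht) 2)
  have hs1 : (0 : ℝ) < 1 - 7 / (8 * M) := by
    rw [sub_pos, div_lt_one (by positivity)]
    linarith
  have hfin : (8 * (1 - 7 / (8 * M) : ℝ) ^ (M - 1)) ^ S.card ≤
      (max 1 ((ζ / γ) ^ 2 / M)) ^ M := by
    have h1 := hdet.trans ((det_le_trace_div_pow hA hM).trans
      (pow_le_pow_left₀ (div_nonneg hA.posSemidef.trace_nonneg (by positivity))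
        (div_le_div_of_nonneg_right htr (by positivity)) M))
    rw [← div_eq_mul_inv, div_le_iff₀ (by positivity), pow_mul, ← mul_pow] at h1
    refine h1.trans (le_of_eq ?_)
    congr 1
    rw [← max_div_div_right (by positivity), max_mul_of_nonneg _ _ (by positivity)]
    congr 1 <;> field_simp
  have hlog := Real.log_le_log (by positivity) hfin
  rw [Real.log_pow, Real.log_mul (by norm_num) (by positivity), Real.log_pow, Real.log_pow] at hlog
  have hm := neg_le_mul_log_one_sub hM
  have h8 : Real.log 8 = 3 * Real.log 2 := by
    rw [show (8 : ℝ) = 2 ^ 3 by norm_num, Real.log_pow]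
    norm_num
  have hl2 := Real.log_two_gt_d9
  have hc0 : (0 : ℝ) ≤ S.card := by positivity
  -- In the first case there are no cuts at all. In the second, the slack for the `-1` comes from `M
  -- * log M ≥ 2 * log 2` if `M ≥ 2`, and from the full factor 8 per cut together with `L ≥ 1` if `M
  -- = 1`.
  rcases le_total ((ζ / γ) ^ 2 / M) 1 with h | h
  · rw [max_eq_left h, Real.log_one, mul_zero] at hlog
    nlinarith
  · rw [max_eq_right h, Real.log_div (by positivity) (by positivity), Real.log_pow,
      ← hLdef] at hlog
    push_cast at hlog
    rcases Nat.lt_or_ge 1 M with h2 | h2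
    · have hM2 : (2 : ℝ) ≤ M := by exact_mod_cast h2
      have hlM := Real.log_le_log (by norm_num) hM2
      nlinarith
    · obtain rfl : M = 1 := by omega
      simp only [Nat.sub_self, Nat.cast_one, Nat.cast_zero, zero_mul, add_zero, Real.log_one,
        sub_zero, one_mul] at hlog ⊢
      nlinarith

end Ellipsoids

/-! ### Deterministic analysis of good runs -/

section GoodRuns

variable {X : Type u} {A : Type v} [MeasurableSpace X] [MeasurableSpace A]
  [MeasurableSingletonClass A] [Fintype A] [DecidableEq A] [Nonempty A] {H N M T : ℕ}
  {m : SampleSizes} {C : CDP X A H} {F : ValueClass X A N} {ζ ε φ : ℝ}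

/-- All choices in the run are admissible, and all estimates are accurate. -/
structure GoodRun (C : CDP X A H) (F : ValueClass X A N) (ε φ : ℝ) (ω : Run X A H N m T) :
    Prop where
  start : ∀ i, |empValue F ω.1 i - predValue C F i| ≤ ε / 8
  pick : ∀ r : Fin T, (surviving F φ ω r).Nonempty → (ω.2 r).1 ∈ surviving F φ ω r ∧
    ∀ j ∈ surviving F φ ω r, empValue F ω.1 j ≤ empValue F ω.1 (ω.2 r).1
  eval : ∀ (r : Fin T) h, |empOwnError F (ω.2 r).2.1 (ω.2 r).1 h
    - bellmanError C F (ω.2 r).1 (F.greedy (ω.2 r).1) h| ≤ ε / (8 * H)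
  level : ∀ r : Fin T, ¬ Stops F ε (ω.2 r).2.1 (ω.2 r).1 →
    5 * ε / (8 * H) ≤ empOwnError F (ω.2 r).2.1 (ω.2 r).1 (ω.2 r).2.2.1
  explore : ∀ (r : Fin T) j, |empError F (ω.2 r).2.2.2 j (ω.2 r).2.2.1
    - bellmanError C F j (F.greedy (ω.2 r).1) (ω.2 r).2.2.1| ≤ φ

variable {ω : Run X A H N m T}

omit [MeasurableSingletonClass A] [Nonempty A] in
theorem GoodRun.valid_mem_surviving (hω : GoodRun C F ε φ ω) {i : Fin N} (hi : Valid C F i)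
    (s : ℕ) : i ∈ surviving F φ ω s := by
  intro r _
  simpa [hi _ _] using hω.explore r i

omit [MeasurableSingletonClass A] [Nonempty A] in
theorem GoodRun.exists_stops (hω : GoodRun C F ε φ ω) (hε : 0 < ε) (hH : 0 < H) (hM : 0 < M)
    (hv : ∃ i, Valid C F i) (hf : BellmanFactorization C F M ζ)
    (hL : 1 ≤ Real.log (6 * H * √M * ζ / ε)) (hφ : φ = ε / (12 * H * √M)) (hζ : 0 < ζ)
    (hT : 2 * H * M * Real.log (6 * H * √M * ζ / ε) - 1 < T) :
    ∃ r : Fin T, Stops F ε (ω.2 r).2.1 (ω.2 r).1 := by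
  obtain ⟨i₀, hi₀⟩ := hv
  obtain ⟨ν, ξ, hνξ⟩ := hf
  by_contra! hno
  have hH' : (1 : ℝ) ≤ H := by exact_mod_cast hH
  have hM' : (1 : ℝ) ≤ M := by exact_mod_cast hM
  have hsM : 0 < √(M : ℝ) := Real.sqrt_pos.2 (by positivity)
  have hφ0 : 0 < φ := by rw [hφ]; positivity
  -- The cuts have width `γ = 2 * φ`: elimination threshold `φ` plus estimation error `φ`.
  have hLe : 6 * H * √M * ζ / ε = ζ / (2 * φ) := by
    rw [hφ]
    field_simp
    ring
  rw [hLe] at hL hT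
  have hcard : ∀ h : Fin H, ((Finset.univ.filter fun r : Fin T => (ω.2 r).2.2.1 = h).card : ℝ) ≤
      2 * M * Real.log (ζ / (2 * φ)) - 1 := by
    intro h
    refine card_le_of_deep_cuts hM (by positivity) hL hζ (fun r => ν h (ω.2 r).1)
      (fun r => ξ h (ω.2 r).1) _ (fun s _ t _ => (hνξ _ _ h).2) ?_ ?_
    · intro s hs t _ hst
      have hs' : (ω.2 s).2.2.1 = h := by simpa using hs
      have h1 := (hω.pick t ⟨i₀, hω.valid_mem_surviving hi₀ _⟩).1 s hst
      have h2 := hω.explore s (ω.2 t).1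
      rw [hs'] at h1 h2
      rw [← (hνξ _ _ h).1]
      rw [abs_le] at h1 h2 ⊢
      constructor <;> linarith [h1.1, h1.2, h2.1, h2.2]
    · intro t ht
      have ht' : (ω.2 t).2.2.1 = h := by simpa using ht
      have h1 := hω.level t (hno t)
      have h2 := hω.eval t h
      rw [ht'] at h1
      rw [← (hνξ _ _ h).1]
      refine le_trans ?_ (le_abs_self _)
      -- The choice of `φ` makes the required cut depth equal to `ε / (2H)`, the empirical `5ε /
      -- (8H)` minus the tolerance `ε / (8H)`.
      have e1 : 3 * √M * (2 * φ) = 4 * (ε / (8 * H)) := by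
        rw [hφ]
        field_simp
        ring
      have e2 : 5 * ε / (8 * H) = 5 * (ε / (8 * H)) := by ring
      rw [e1]
      rw [e2] at h1
      linarith [(abs_le.1 h2).2]
  have hsum : (T : ℝ) ≤ H * (2 * M * Real.log (ζ / (2 * φ)) - 1) := by
    have e := Finset.card_eq_sum_card_fiberwise (s := (Finset.univ : Finset (Fin T)))
      (t := Finset.univ) (f := fun r => (ω.2 r).2.2.1) (fun _ _ => by simp)
    rw [Finset.card_univ, Fintype.card_fin] at e
    calc (T : ℝ) = ∑ h : Fin H,
          ((Finset.univ.filter fun r : Fin T => (ω.2 r).2.2.1 = h).card : ℝ) := by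
          exact_mod_cast e
      _ ≤ ∑ _h : Fin H, (2 * M * Real.log (ζ / (2 * φ)) - 1) :=
          Finset.sum_le_sum fun h _ => hcard h
      _ = _ := by rw [Finset.sum_const, Finset.card_univ, Fintype.card_fin, nsmul_eq_mul]
  -- The `-1` per level adds up to `-H ≤ -1`, which contradicts `hT`. Thus the halting iteration
  -- itself fits into `T`.
  nlinarith

omit [Nonempty A] in
theorem GoodRun.value_ge (hω : GoodRun C F ε φ ω) (hC : C.BoundedRewards) (hH : 0 < H)
    (hv : ∃ i, Valid C F i) {s : Fin T} (hs : Stops F ε (ω.2 s).2.1 (ω.2 s).1) :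
    optValue C F - ε ≤ C.value (output F ω s) := by
  obtain ⟨i₀, hi₀⟩ := hv
  have hH' : (0 : ℝ) < H := by exact_mod_cast hH
  have : Nonempty {i : Fin N // Valid C F i} := ⟨⟨i₀, hi₀⟩⟩
  rw [sub_le_iff_le_add]
  refine ciSup_le fun ⟨i, hi⟩ => ?_
  have hpick := (hω.pick s ⟨i₀, hω.valid_mem_surviving hi₀ _⟩).2 i (hω.valid_mem_surviving hi _)
  have h1 := abs_le.1 (hω.start i)
  have h2 := abs_le.1 (hω.start (ω.2 s).1)
  have d1 := predValue_sub_value F hH hC i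
  have d2 := predValue_sub_value F hH hC (ω.2 s).1
  rw [Finset.sum_eq_zero fun h _ => hi i h] at d1
  have h3 : ∑ h, bellmanError C F (ω.2 s).1 (F.greedy (ω.2 s).1) h ≤
      5 * ε / 8 + ε / 8 := by
    calc _ ≤ ∑ h, (empOwnError F (ω.2 s).2.1 (ω.2 s).1 h + ε / (8 * H)) :=
          Finset.sum_le_sum fun h _ => by linarith [(abs_le.1 (hω.eval s h)).1]
      _ ≤ 5 * ε / 8 + ε / 8 := by
          rw [Finset.sum_add_distrib]
          refine add_le_add hs (le_of_eq ?_)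
          simp only [Finset.sum_const, Finset.card_univ, Fintype.card_fin, nsmul_eq_mul]
          field_simp
  change C.value (F.greedy i) ≤ C.value (F.greedy (ω.2 s).1) + ε
  -- The loss splits into `ε/8` for each of two predicted values and `6ε/8` for the sum of Bellman
  -- errors.
  linarith [h1.1, h2.2]

omit [Nonempty A] in
theorem GoodRun.exists_haltsAt (hω : GoodRun C F ε φ ω) (hC : C.BoundedRewards) (hε : 0 < ε)
    (hH : 0 < H) (hM : 0 < M) (hv : ∃ i, Valid C F i) (hf : BellmanFactorization C F M ζ)
    (hL : 1 ≤ Real.log (6 * H * √M * ζ / ε)) (hφ : φ = ε / (12 * H * √M)) (hζ : 0 < ζ)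
    (hT : 2 * H * M * Real.log (6 * H * √M * ζ / ε) - 1 < T) :
    ∃ s : Fin T, HaltsAt F ε φ ω s ∧ optValue C F - ε ≤ C.value (output F ω s) := by
  obtain ⟨s, hs, hmin⟩ := exists_minimal_of_wellFoundedLT
    (fun r : Fin T => Stops F ε (ω.2 r).2.1 (ω.2 r).1)
    (hω.exists_stops hε hH hM hv hf hL hφ hζ hT)
  refine ⟨s, ⟨?_, hs, fun r hr hst => absurd (hmin hst hr.le) (not_le.2 hr)⟩,
    hω.value_ge hC hH hv hs⟩
  obtain ⟨i₀, hi₀⟩ := hv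
  exact ⟨i₀, hω.valid_mem_surviving hi₀ _⟩

end GoodRuns

/-! ### Measurability of the estimates in data and indices -/

section Measurability

variable {X : Type u} {A : Type v} [MeasurableSpace X] [MeasurableSpace A]
  [MeasurableSingletonClass A] {H N : ℕ} (F : ValueClass X A N) {n : ℕ}

@[fun_prop]
theorem measurable_empValue [Finite A] (i : Fin N) :
    Measurable (fun d : Fin n → Hist X A H => empValue F d i) := by
  have h : ∀ k : Fin n, Measurable (fun d : Fin n → Hist X A H =>
      F.val i (ctx (d k) 0) ((F.greedy i).1 (ctx (d k) 0))) := fun k =>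
    (measurable_val_greedy F i).comp ((measurable_ctx 0).comp (measurable_pi_apply k))
  unfold empValue
  fun_prop

theorem measurable_empOwnError [Finite A] (i : Fin N) (h : Fin H) :
    Measurable (fun d : Fin n → Hist X A H => empOwnError F d i h) := by
  unfold empOwnError
  fun_prop

theorem measurable_empError [Fintype A] [DecidableEq A] (i : Fin N) (h : Fin H) :
    Measurable (fun d : Fin n → Hist X A H => empError F d i h) := by
  simp_rw [empError_eq]
  fun_prop

variable {Ω : Type*} [MeasurableSpace Ω]

@[fun_prop]
theorem measurable_empValue_comp [Finite A] {d : Ω → Fin n → Hist X A H} {i : Ω → Fin N}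
    (hd : Measurable d) (hi : Measurable i) : Measurable (fun ω => empValue F (d ω) (i ω)) :=
  (measurable_from_prod_countable_left (f := fun p : (Fin n → Hist X A H) × Fin N =>
    empValue F p.1 p.2) fun i => measurable_empValue F i).comp (hd.prodMk hi)

@[fun_prop]
theorem measurable_empOwnError_comp [Finite A] {d : Ω → Fin n → Hist X A H} {i : Ω → Fin N}
    {h : Ω → Fin H} (hd : Measurable d) (hi : Measurable i) (hh : Measurable h) :
    Measurable (fun ω => empOwnError F (d ω) (i ω) (h ω)) :=
  (measurable_from_prod_countable_left (f := fun p : (Fin n → Hist X A H) × (Fin N × Fin H) =>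
    empOwnError F p.1 p.2.1 p.2.2) fun q => measurable_empOwnError F q.1 q.2).comp
      (hd.prodMk (hi.prodMk hh))

@[fun_prop]
theorem measurable_empError_comp [Fintype A] [DecidableEq A] {d : Ω → Fin n → Hist X A H}
    {i : Ω → Fin N} {h : Ω → Fin H} (hd : Measurable d) (hi : Measurable i) (hh : Measurable h) :
    Measurable (fun ω => empError F (d ω) (i ω) (h ω)) :=
  (measurable_from_prod_countable_left (f := fun p : (Fin n → Hist X A H) × (Fin N × Fin H) =>
    empError F p.1 p.2.1 p.2.2) fun q => measurable_empError F q.1 q.2).comp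
      (hd.prodMk (hi.prodMk hh))

theorem measurable_mem_surviving [Fintype A] [DecidableEq A] (φ : ℝ) {m : SampleSizes} {t : ℕ}
    (s : ℕ) {ω : Ω → Run X A H N m t} {i : Ω → Fin N} (hω : Measurable ω) (hi : Measurable i) :
    Measurable (fun x => i x ∈ surviving F φ (ω x) s) := by
  change Measurable fun x => ∀ r : Fin t, (r : ℕ) < s →
    |empError F ((ω x).2 r).2.2.2 (i x) ((ω x).2 r).2.2.1| ≤ φ
  refine Measurable.forall fun r => Measurable.imp measurable_const ?_
  exact measurableSet_setOfPred.1 (measurableSet_le (by fun_prop) measurable_const)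

end Measurability

/-! ### Events within one iteration, reduced to its component kernels -/

section UnionBound

variable {X : Type u} {A : Type v} [MeasurableSpace X] [MeasurableSpace A]
  [Fintype A] [DecidableEq A] [Nonempty A] {H N : ℕ} {m : SampleSizes} {C : CDP X A H}
  {F : ValueClass X A N} {ε φ : ℝ}

instance evalKernel_markov (n : ℕ) : IsMarkovKernel (evalKernel C F n) := ⟨fun i => by
  change IsProbabilityMeasure (Measure.pi _)
  infer_instance⟩

instance exploreKernel_markov (n : ℕ) : IsMarkovKernel (exploreKernel C F n) := ⟨fun i => by
  change IsProbabilityMeasure (Measure.pi _)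
  infer_instance⟩

variable (S : Choices C F m ε φ) (t : ℕ)

instance Choices.iteration_markov : IsMarkovKernel (S.iteration t) := by
  have := S.pick_markov t
  have := S.level_markov t
  unfold Choices.iteration
  infer_instance

variable (ω : Run X A H N m t)

theorem Choices.iteration_pick {B : Set (Fin N)} :
    S.iteration t ω {p | p.1 ∈ B} = S.pick t ω B := by
  have := S.pick_markov t
  have := S.level_markov t
  exact compProd_fst_le _ _ ω (Set.to_countable B).measurableSet

theorem Choices.iteration_eval {B : Set (Fin N × (Fin m.nEval → Hist X A H))}
    (hB : MeasurableSet B) {p : ENNReal}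
    (h : ∀ i, evalKernel C F m.nEval i (Prod.mk i ⁻¹' B) ≤ p) :
    S.iteration t ω {q | (q.1, q.2.1) ∈ B} ≤ p := by
  have := S.pick_markov t
  have := S.level_markov t
  refine compProd_le _ _ ω (Measurable.prodMk (by fun_prop) (by fun_prop) hB) fun i => ?_
  refine le_trans (le_of_eq ?_) (h i)
  exact compProd_fst_le _ _ _ (measurable_prodMk_left hB)

theorem Choices.iteration_level {B : Set (Fin N × (Fin m.nEval → Hist X A H) × Fin H)}
    (hB : MeasurableSet B) {p : ENNReal}
    (h : ∀ i d, S.level t ((ω, i), d) {l | (i, d, l) ∈ B} ≤ p) :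
    S.iteration t ω {q | (q.1, q.2.1, q.2.2.1) ∈ B} ≤ p := by
  have := S.pick_markov t
  have := S.level_markov t
  refine compProd_le _ _ ω (Measurable.prodMk (by fun_prop) (by fun_prop) hB) fun i => ?_
  refine compProd_le _ _ _ (Measurable.prodMk (g := fun q : (Fin m.nEval → Hist X A H) ×
    Fin H × (Fin m.nExp → Hist X A H) => (q.1, q.2.1)) measurable_const (by fun_prop) hB)
      fun d => ?_
  refine le_trans (le_of_eq ?_) (h i d)
  exact compProd_fst_le _ _ _ (B := {l | (i, d, l) ∈ B}) (Set.to_countable _).measurableSet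

theorem Choices.iteration_explore {B : Set ((Fin N × Fin H) × (Fin m.nExp → Hist X A H))}
    (hB : MeasurableSet B) {p : ENNReal}
    (h : ∀ q, exploreKernel C F m.nExp q (Prod.mk q ⁻¹' B) ≤ p) :
    S.iteration t ω {q | ((q.1, q.2.2.1), q.2.2.2) ∈ B} ≤ p := by
  have := S.pick_markov t
  have := S.level_markov t
  refine compProd_le _ _ ω (Measurable.prodMk (by fun_prop) (by fun_prop) hB) fun i => ?_
  refine compProd_le _ _ _ (Measurable.prodMk (f := fun q : (Fin m.nEval → Hist X A H) ×
    Fin H × (Fin m.nExp → Hist X A H) => (i, q.2.1)) (by fun_prop) (by fun_prop) hB)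
      fun d => ?_
  exact compProd_le _ _ _ (Measurable.prodMk (f := fun q : Fin H × (Fin m.nExp → Hist X A H) =>
    (i, q.1)) (by fun_prop) (by fun_prop) hB) fun l => h (i, l)

end UnionBound

/-! ### Probability of bad runs -/

section UnionBound

set_option synthInstance.maxSize 1000

variable {X : Type u} {A : Type v} [MeasurableSpace X] [MeasurableSpace A]
  [MeasurableSingletonClass A] [Fintype A] [DecidableEq A] [Nonempty A] {H N : ℕ}
  {m : SampleSizes} {C : CDP X A H} {F : ValueClass X A N} {ε φ : ℝ}
  (S : Choices C F m ε φ) {t T : ℕ}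

omit [MeasurableSingletonClass A] in
theorem Choices.law_iteration_le (h : t < T)
    {B : Set (Run X A H N m t × Record X A H N m)} (hB : MeasurableSet B) {p : ENNReal}
    (hp : ∀ ω, S.iteration t ω (Prod.mk ω ⁻¹' B) ≤ p) :
    S.law T {ω | (trunc h.le ω, ω.2 ⟨t, h⟩) ∈ B} ≤ p := by
  have := isProbabilityMeasure_seqLaw (Measure.dirac ()) S.start (start_markov S.start_spec) m.nEst
  have := Measure.isProbabilityMeasure_map (μ := seqLaw (Measure.dirac ()) S.start m.nEst)
    (f := Prod.snd) measurable_snd.aemeasurable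
  exact seqLaw_record_le _ S.iteration (fun _ => inferInstance) h hB hp

theorem Choices.law_start_le (T : ℕ) {x : ℝ} (hx : 0 ≤ x) (hn : 0 < m.nEst) (i : Fin N) :
    S.law T {ω | x < |empValue F ω.1 i - predValue C F i|} ≤
      ENNReal.ofReal (2 * Real.exp (-(m.nEst * (2 * x ^ 2)))) := by
  have := isProbabilityMeasure_seqLaw (Measure.dirac ()) S.start (start_markov S.start_spec) m.nEst
  have := Measure.isProbabilityMeasure_map (μ := seqLaw (Measure.dirac ()) S.start m.nEst)
    (f := Prod.snd) measurable_snd.aemeasurable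
  refine le_trans (le_of_eq ?_) (empValue_deviation F i S.start_spec hn hx)
  have e := seqLaw_map_trunc ((seqLaw (Measure.dirac ()) S.start m.nEst).map Prod.snd)
    S.iteration (fun _ => inferInstance) T.zero_le
  have e' := congrArg (Measure.map Prod.fst) e
  rw [Measure.map_map measurable_fst (measurable_trunc _), seqLaw,
    Measure.map_map measurable_fst (by fun_prop)] at e'
  have hm : MeasurableSet {d : Fin m.nEst → Hist X A H |
      x < |empValue F d i - predValue C F i|} :=
    measurableSet_lt measurable_const (by fun_prop)
  have e2 := congrArg (fun μ => μ {d : Fin m.nEst → Hist X A H |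
      x < |empValue F d i - predValue C F i|}) e'
  rw [Measure.map_apply (by fun_prop) hm] at e2
  refine e2.trans ?_
  congr 1
  exact Measure.map_id

theorem Choices.law_pick_eq_zero (h : t < T) :
    S.law T {ω | ¬ ((surviving F φ ω t).Nonempty → (ω.2 ⟨t, h⟩).1 ∈ surviving F φ ω t ∧
      ∀ j ∈ surviving F φ ω t, empValue F ω.1 j ≤ empValue F ω.1 (ω.2 ⟨t, h⟩).1)} = 0 := by
  -- The survivors before iteration `t` depend only on the first `t` records.
  have hs : ∀ ω : Run X A H N m T, surviving F φ (trunc h.le ω) t = surviving F φ ω t := by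
    intro ω
    ext i
    exact ⟨fun hi r hr => hi ⟨r, hr⟩ hr, fun hi r hr => hi (Fin.castLE h.le r) hr⟩
  set B : Set (Run X A H N m t × Record X A H N m) := {q | ¬ ((∃ j, j ∈ surviving F φ q.1 t) →
    q.2.1 ∈ surviving F φ q.1 t ∧
      ∀ j, j ∈ surviving F φ q.1 t → empValue F q.1.1 j ≤ empValue F q.1.1 q.2.1)} with hBdef
  have hB : MeasurableSet B := by
    have h1 : ∀ j, Measurable fun q : Run X A H N m t × Record X A H N m =>
        j ∈ surviving F φ q.1 t := fun j =>
      measurable_mem_surviving F φ t measurable_fst measurable_const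
    have h2 : Measurable fun q : Run X A H N m t × Record X A H N m =>
        q.2.1 ∈ surviving F φ q.1 t :=
      measurable_mem_surviving F φ t measurable_fst (by fun_prop)
    refine measurableSet_setOfPred.2 (Measurable.not ((Measurable.exists h1).imp
      (h2.and (Measurable.forall fun j => (h1 j).imp ?_))))
    exact measurableSet_setOfPred.1 (measurableSet_le (by fun_prop) (by fun_prop))
  have key := S.law_iteration_le h hB (p := 0) fun ω => by
    have hz : S.pick t ω {i | ¬ ((surviving F φ ω t).Nonempty → i ∈ surviving F φ ω t ∧
        ∀ j ∈ surviving F φ ω t, empValue F ω.1 j ≤ empValue F ω.1 i)} = 0 := by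
      refine ae_iff.1 ?_
      by_cases hne : (surviving F φ ω t).Nonempty
      · filter_upwards [S.pick_spec t ω hne] with i hi _ using hi
      · exact Filter.Eventually.of_forall fun i hne' => absurd hne' hne
    rw [← S.iteration_pick t ω] at hz
    exact hz.le
  refine le_antisymm (le_trans (le_of_eq ?_) key) zero_le
  simp only [hBdef, Set.mem_ofPred_eq, hs]
  rfl

theorem Choices.law_eval_le (hC : C.BoundedRewards) {x : ℝ} (hx : 0 ≤ x) (hn : 0 < m.nEval)
    (h : t < T) (l : Fin H) :
    S.law T {ω | x < |empOwnError F (ω.2 ⟨t, h⟩).2.1 (ω.2 ⟨t, h⟩).1 l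
      - bellmanError C F (ω.2 ⟨t, h⟩).1 (F.greedy (ω.2 ⟨t, h⟩).1) l|} ≤
      ENNReal.ofReal (2 * Real.exp (-(m.nEval * (2 * x ^ 2 / 9)))) := by
  have hb : Measurable fun q : Fin N × (Fin m.nEval → Hist X A H) =>
      bellmanError C F q.1 (F.greedy q.1) l :=
    (measurable_of_finite fun i => bellmanError C F i (F.greedy i) l).comp measurable_fst
  set B : Set (Fin N × (Fin m.nEval → Hist X A H)) := {q | x < |empOwnError F q.2 q.1 l
      - bellmanError C F q.1 (F.greedy q.1) l|}
  have hB : MeasurableSet B := measurableSet_lt measurable_const (by fun_prop)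
  refine S.law_iteration_le h (B := {q | (q.2.1, q.2.2.1) ∈ B})
    (Measurable.prodMk (by fun_prop) (by fun_prop) hB) fun ω => ?_
  exact S.iteration_eval t ω hB fun i => empOwnError_deviation F hC i l hn hx

theorem Choices.law_level_eq_zero (h : t < T) :
    S.law T {ω | ¬ (¬ Stops F ε (ω.2 ⟨t, h⟩).2.1 (ω.2 ⟨t, h⟩).1 → 5 * ε / (8 * H) ≤
      empOwnError F (ω.2 ⟨t, h⟩).2.1 (ω.2 ⟨t, h⟩).1 (ω.2 ⟨t, h⟩).2.2.1)} = 0 := by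
  set B : Set (Fin N × (Fin m.nEval → Hist X A H) × Fin H) :=
    {q | ¬ (¬ Stops F ε q.2.1 q.1 → 5 * ε / (8 * H) ≤ empOwnError F q.2.1 q.1 q.2.2)}
  have hB : MeasurableSet B := by
    refine measurableSet_setOfPred.2 (Measurable.not (Measurable.imp (Measurable.not ?_) ?_))
    · exact measurableSet_setOfPred.1 (measurableSet_le (by fun_prop) measurable_const)
    · exact measurableSet_setOfPred.1 (measurableSet_le measurable_const (by fun_prop))
  refine le_antisymm (S.law_iteration_le h (B := {q | (q.2.1, q.2.2.1, q.2.2.2.1) ∈ B})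
    (Measurable.prodMk (by fun_prop) (Measurable.prodMk (by fun_prop) (by fun_prop)) hB)
      fun ω => ?_) zero_le
  refine S.iteration_level t ω hB fun i d => le_of_eq (ae_iff.1 ?_)
  by_cases hs : Stops F ε d i
  · exact Filter.Eventually.of_forall fun l hl => absurd hs hl
  · filter_upwards [S.level_spec t ω i d hs] with l hl _ using hl

theorem Choices.law_explore_le (hC : C.BoundedRewards) {x : ℝ} (hx : 0 ≤ x) (hx4 : x ≤ 4)
    (hn : 0 < m.nExp) (h : t < T) (j : Fin N) :
    S.law T {ω | x < |empError F (ω.2 ⟨t, h⟩).2.2.2 j (ω.2 ⟨t, h⟩).2.2.1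
      - bellmanError C F j (F.greedy (ω.2 ⟨t, h⟩).1) (ω.2 ⟨t, h⟩).2.2.1|} ≤
      ENNReal.ofReal (2 * Real.exp (-(m.nExp * (x ^ 2 / (16 * Fintype.card A))))) := by
  have hb : Measurable fun q : (Fin N × Fin H) × (Fin m.nExp → Hist X A H) =>
      bellmanError C F j (F.greedy q.1.1) q.1.2 :=
    (measurable_of_finite fun q : Fin N × Fin H =>
      bellmanError C F j (F.greedy q.1) q.2).comp measurable_fst
  set B : Set ((Fin N × Fin H) × (Fin m.nExp → Hist X A H)) := {q | x <
    |empError F q.2 j q.1.2 - bellmanError C F j (F.greedy q.1.1) q.1.2|}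
  have hB : MeasurableSet B := measurableSet_lt measurable_const (by fun_prop)
  refine S.law_iteration_le h (B := {q | ((q.2.1, q.2.2.2.1), q.2.2.2.2) ∈ B})
    (Measurable.prodMk (by fun_prop) (by fun_prop) hB) fun ω => ?_
  exact S.iteration_explore t ω hB fun q => empError_deviation F hC j q.1 q.2 hn hx hx4

/-- Per iteration, evaluation needs a union over the `H` levels for the single chosen function, and
exploration a union over the `N` functions at the single chosen level. Inadmissible choices have
probability zero. -/
theorem Choices.law_not_goodRun_le (hC : C.BoundedRewards) (hε : 0 ≤ ε) (hφ : 0 ≤ φ) (hφ4 : φ ≤ 4)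
    (h1 : 0 < m.nEst) (h2 : 0 < m.nEval) (h3 : 0 < m.nExp) (T : ℕ) {p₁ p₂ p₃ : ℝ}
    (hp₁ : 2 * Real.exp (-(m.nEst * (2 * (ε / 8) ^ 2))) ≤ p₁)
    (hp₂ : 2 * Real.exp (-(m.nEval * (2 * (ε / (8 * H)) ^ 2 / 9))) ≤ p₂)
    (hp₃ : 2 * Real.exp (-(m.nExp * (φ ^ 2 / (16 * Fintype.card A)))) ≤ p₃) :
    S.law T {ω | ¬ GoodRun C F ε φ ω} ≤
      ENNReal.ofReal (N * p₁ + T * (H * p₂ + N * p₃)) := by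
  have n1 : 0 ≤ p₁ := le_trans (by positivity) hp₁
  have n2 : 0 ≤ p₂ := le_trans (by positivity) hp₂
  have n3 : 0 ≤ p₃ := le_trans (by positivity) hp₃
  set B1 : Set (Run X A H N m T) := ⋃ i, {ω | ε / 8 < |empValue F ω.1 i - predValue C F i|}
  set B2 : Fin T → Set (Run X A H N m T) := fun r => {ω | ¬ ((surviving F φ ω r).Nonempty →
    (ω.2 r).1 ∈ surviving F φ ω r ∧
      ∀ j ∈ surviving F φ ω r, empValue F ω.1 j ≤ empValue F ω.1 (ω.2 r).1)}
  set B3 : Fin T → Set (Run X A H N m T) := fun r => ⋃ l, {ω | ε / (8 * H) <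
    |empOwnError F (ω.2 r).2.1 (ω.2 r).1 l
      - bellmanError C F (ω.2 r).1 (F.greedy (ω.2 r).1) l|}
  set B4 : Fin T → Set (Run X A H N m T) := fun r => {ω | ¬ (¬ Stops F ε (ω.2 r).2.1 (ω.2 r).1 →
    5 * ε / (8 * H) ≤ empOwnError F (ω.2 r).2.1 (ω.2 r).1 (ω.2 r).2.2.1)}
  set B5 : Fin T → Set (Run X A H N m T) := fun r => ⋃ j, {ω | φ <
    |empError F (ω.2 r).2.2.2 j (ω.2 r).2.2.1
      - bellmanError C F j (F.greedy (ω.2 r).1) (ω.2 r).2.2.1|}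
  have hsub : {ω : Run X A H N m T | ¬ GoodRun C F ε φ ω} ⊆
      B1 ∪ ⋃ r, (B2 r ∪ B3 r ∪ B4 r ∪ B5 r) := by
    intro ω hω
    by_contra hn
    simp only [Set.mem_union, Set.mem_iUnion, not_or, not_exists, B1, B2, B3, B4, B5,
      Set.mem_ofPred_eq, not_lt, not_not] at hn
    exact hω ⟨hn.1, fun r => (hn.2 r).1.1.1, fun r => (hn.2 r).1.1.2, fun r => (hn.2 r).1.2,
      fun r => (hn.2 r).2⟩
  have b1 : S.law T B1 ≤ ENNReal.ofReal (N * p₁) := by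
    refine (measure_iUnion_fintype_le _ _).trans ?_
    calc _ ≤ ∑ _i : Fin N, ENNReal.ofReal p₁ := Finset.sum_le_sum fun i _ =>
          (S.law_start_le T (by positivity) h1 i).trans (ENNReal.ofReal_le_ofReal hp₁)
      _ = _ := by simp [ENNReal.ofReal_mul]
  have b3 : ∀ r, S.law T (B3 r) ≤ ENNReal.ofReal (H * p₂) := fun r => by
    refine (measure_iUnion_fintype_le _ _).trans ?_
    calc _ ≤ ∑ _i : Fin H, ENNReal.ofReal p₂ := Finset.sum_le_sum fun l _ =>
          (S.law_eval_le hC (by positivity) h2 r.isLt l).trans (ENNReal.ofReal_le_ofReal hp₂)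
      _ = _ := by simp [ENNReal.ofReal_mul]
  have b5 : ∀ r, S.law T (B5 r) ≤ ENNReal.ofReal (N * p₃) := fun r => by
    refine (measure_iUnion_fintype_le _ _).trans ?_
    calc _ ≤ ∑ _i : Fin N, ENNReal.ofReal p₃ := Finset.sum_le_sum fun j _ =>
          (S.law_explore_le hC hφ hφ4 h3 r.isLt j).trans (ENNReal.ofReal_le_ofReal hp₃)
      _ = _ := by simp [ENNReal.ofReal_mul]
  have br : ∀ r, S.law T (B2 r ∪ B3 r ∪ B4 r ∪ B5 r) ≤ ENNReal.ofReal (H * p₂ + N * p₃) :=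
    fun r => by
    rw [ENNReal.ofReal_add (by positivity) (by positivity)]
    refine (measure_union_le _ _).trans (add_le_add ?_ (b5 r))
    refine (measure_union_le _ _).trans ?_
    rw [show S.law T (B4 r) = 0 from S.law_level_eq_zero r.isLt, add_zero]
    refine (measure_union_le _ _).trans ?_
    rw [show S.law T (B2 r) = 0 from S.law_pick_eq_zero r.isLt, zero_add]
    exact b3 r
  refine (measure_mono hsub).trans ((measure_union_le _ _).trans ?_)
  rw [ENNReal.ofReal_add (by positivity) (by positivity)]
  refine add_le_add b1 ((measure_iUnion_fintype_le _ _).trans ?_)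
  calc _ ≤ ∑ _r : Fin T, ENNReal.ofReal (H * p₂ + N * p₃) := Finset.sum_le_sum fun r _ => br r
    _ = _ := by rw [ENNReal.ofReal_mul (by positivity)]; simp

end UnionBound

/-! ### Sample sizes and the number of episodes -/

section SampleSizes

theorem BellmanFactorization.pos {X : Type u} {A : Type v} [MeasurableSpace X]
    [MeasurableSpace A] {H N M : ℕ} {ζ x : ℝ} {C : CDP X A H} {F : ValueClass X A N} (hH : 0 < H)
    (hf : BellmanFactorization C F M ζ) (i : Fin N) (hL : 1 ≤ Real.log (x * ζ)) : 0 < ζ := by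
  obtain ⟨ν, ξ, h⟩ := hf
  have h0 : 0 ≤ ζ := (by positivity : 0 ≤ ‖ν ⟨0, hH⟩ i‖ * ‖ξ ⟨0, hH⟩ i‖).trans (h i i ⟨0, hH⟩).2
  refine h0.lt_of_ne fun h1 => ?_
  -- The convention `Real.log 0 = 0` is incompatible with `L ≥ 1`.
  rw [← h1, mul_zero, Real.log_zero] at hL
  linarith

theorem two_mul_exp_neg_le {n : ℕ} {a x Q : ℝ} (hQ : 1 ≤ Q) (hx : 0 ≤ x) (hax : 1 ≤ a * x)
    (hn : n = ⌈a * Real.log Q⌉₊) : 2 * Real.exp (-(n * x)) ≤ 2 / Q := by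
  have h1 : a * Real.log Q ≤ n := hn ▸ Nat.le_ceil _
  have h2 : Real.log Q ≤ n * x := by
    calc Real.log Q = 1 * Real.log Q := (one_mul _).symm
      _ ≤ a * x * Real.log Q := by gcongr; exact Real.log_nonneg hQ
      _ = a * Real.log Q * x := by ring
      _ ≤ n * x := by gcongr
  rw [div_eq_mul_inv]
  refine mul_le_mul_of_nonneg_left ?_ zero_le_two
  calc Real.exp (-(n * x)) ≤ Real.exp (-Real.log Q) := Real.exp_le_exp.2 (neg_le_neg h2)
    _ = Q⁻¹ := by rw [Real.exp_neg, Real.exp_log (by linarith)]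

theorem log_bounds {H N M K : ℕ} {ζ ε δ : ℝ} (hε : 0 < ε) (hε1 : ε < 1)
    (hδ : 0 < δ) (hH : 0 < H) (hN : 0 < N) (hM : 0 < M) (hK : 0 < K) (hζ : 0 < ζ)
    (hL : 1 ≤ Real.log (6 * H * √M * ζ / ε)) {L μ y : ℝ}
    (hLdef : L = Real.log (6 * H * √M * ζ / ε)) (hμdef : μ = max 1 (Real.log (N * ζ / δ)))
    (hy : y = 1 + Real.log (M * H * K * (1 + ζ) / ε)) :
    1 ≤ y ∧ L ≤ 2 * y ∧ Real.log (6 * N / δ) ≤ 5 * (μ * y) ∧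
      Real.log (12 * H ^ 2 * M * L / δ) ≤ 11 * (μ * y) ∧
      Real.log (12 * N * H * M * L / δ) ≤ 10 * (μ * y) := by
  have hH' : (1 : ℝ) ≤ H := by exact_mod_cast hH
  have hN' : (1 : ℝ) ≤ N := by exact_mod_cast hN
  have hM' : (1 : ℝ) ≤ M := by exact_mod_cast hM
  have hK' : (1 : ℝ) ≤ K := by exact_mod_cast hK
  have hsM1 : 1 ≤ √(M : ℝ) := Real.one_le_sqrt.2 hM'
  have hsM : √(M : ℝ) ≤ M := by
    rw [Real.sqrt_le_left (by positivity)]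
    nlinarith
  rw [← hLdef] at hL
  have hμ1 : 1 ≤ μ := hμdef ▸ le_max_left _ _
  have hμ2 : Real.log (N * ζ / δ) ≤ μ := hμdef ▸ le_max_right _ _
  set q := (M * H * K * (1 + ζ) / ε : ℝ)
  have hMHK : (1 : ℝ) ≤ M * H * K := one_le_mul_of_one_le_of_one_le
    (one_le_mul_of_one_le_of_one_le hM' hH') hK'
  have hqle : ∀ x : ℝ, 0 < x → x ≤ M * H * K * (1 + ζ) → Real.log (x / ε) ≤ Real.log q := by
    intro x hx hxle
    exact Real.log_le_log (by positivity) (div_le_div_of_nonneg_right hxle hε.le)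
  have hlogε : Real.log ε ≤ 0 := Real.log_nonpos hε.le hε1.le
  have hle' : ∀ x : ℝ, 0 < x → x ≤ M * H * K * (1 + ζ) → Real.log x ≤ Real.log q := by
    intro x hx hxle
    have := hqle x hx hxle
    rw [Real.log_div hx.ne' hε.ne'] at this
    linarith
  have hMHKζ : (M * H * K : ℝ) ≤ M * H * K * (1 + ζ) := le_mul_of_one_le_right (by positivity)
    (by linarith)
  have hq0 : 0 ≤ Real.log q := by
    have := hle' 1 one_pos (hMHK.trans hMHKζ)
    rwa [Real.log_one] at this
  have hy1 : 1 ≤ y := by linarith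
  have hl6 : Real.log 6 ≤ 2 := by
    rw [Real.log_le_iff_le_exp (by norm_num), show (2 : ℝ) = 1 + 1 by norm_num, Real.exp_add]
    nlinarith [Real.exp_one_gt_d9]
  have hl12 : Real.log 12 ≤ 3 := by
    rw [show (12 : ℝ) = 2 * 6 by norm_num, Real.log_mul (by norm_num) (by norm_num)]
    linarith [Real.log_two_lt_d9]
  have hlH : Real.log H ≤ y - 1 := by
    rw [hy, add_sub_cancel_left]
    refine hle' _ (by positivity) (le_trans ?_ hMHKζ)
    calc (H : ℝ) = 1 * H * 1 := by ring
      _ ≤ M * H * K := by gcongr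
  have hlM : Real.log M ≤ y - 1 := by
    rw [hy, add_sub_cancel_left]
    refine hle' _ (by positivity) (le_trans ?_ hMHKζ)
    calc (M : ℝ) = M * 1 * 1 := by ring
      _ ≤ M * H * K := by gcongr
  have hL2 : L ≤ 2 * y := by
    have e : (6 * H * √M * ζ / ε : ℝ) = 6 * (H * √M * ζ / ε) := by ring
    rw [hLdef, e, Real.log_mul (by norm_num) (by positivity)]
    have : Real.log (H * √M * ζ / ε) ≤ Real.log q := by
      refine hqle _ (by positivity) ?_
      have e1 : (H * √M : ℝ) ≤ M * H * K := by
        calc (H * √M : ℝ) ≤ H * M := by gcongr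
          _ = M * H * 1 := by ring
          _ ≤ M * H * K := by gcongr
      exact mul_le_mul e1 (by linarith) hζ.le (by positivity)
    linarith
  have hlL : Real.log L ≤ 2 * y := (Real.log_le_self (by linarith)).trans hL2
  -- For small `ζ`, `log (Nζ/δ)` may be far below `log (N/δ)`. But `L ≥ 1` bounds `-log ζ` by `log 6
  -- + log (H√M/ε)`, which goes into the polylogarithmic factor `y`.
  have hp : Real.log (N / δ) ≤ μ + 2 * y := by
    have e : Real.log (N * ζ / δ) = Real.log (N / δ) + Real.log ζ := by
      rw [← Real.log_mul (by positivity) hζ.ne']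
      congr 1
      ring
    have e2 : L = Real.log 6 + Real.log (H * √M / ε) + Real.log ζ := by
      rw [hLdef, ← Real.log_mul (by norm_num) (by positivity),
        ← Real.log_mul (by positivity) hζ.ne']
      congr 1
      ring
    have : Real.log (H * √M / ε) ≤ Real.log q := by
      refine hqle _ (by positivity) (le_trans ?_ hMHKζ)
      calc (H * √M : ℝ) ≤ H * M := by gcongr
        _ = M * H * 1 := by ring
        _ ≤ M * H * K := by gcongr
    linarith
  have hμy : y ≤ μ * y := le_mul_of_one_le_left (by linarith) hμ1
  have hμy' : μ ≤ μ * y := le_mul_of_one_le_right (by linarith) hy1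
  have hlδ : Real.log (1 / δ) ≤ Real.log (N / δ) :=
    Real.log_le_log (by positivity) (div_le_div_of_nonneg_right hN' hδ.le)
  have hL0 : 0 < L := by linarith
  have b1 : Real.log (6 * N / δ) ≤ 5 * (μ * y) := by
    rw [mul_div_assoc, Real.log_mul (by norm_num) (by positivity)]
    linarith
  have b2 : Real.log (12 * H ^ 2 * M * L / δ) ≤ 11 * (μ * y) := by
    rw [show (12 * H ^ 2 * M * L / δ : ℝ) = 12 * (H ^ 2 * (M * (L * (1 / δ)))) by ring,
      Real.log_mul (by norm_num) (by positivity), Real.log_mul (by positivity) (by positivity),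
      Real.log_mul (by positivity) (by positivity), Real.log_mul (by positivity) (by positivity),
      Real.log_pow]
    push_cast
    linarith
  have b3 : Real.log (12 * N * H * M * L / δ) ≤ 10 * (μ * y) := by
    rw [show (12 * N * H * M * L / δ : ℝ) = 12 * (H * (M * (L * (N / δ)))) by ring,
      Real.log_mul (by norm_num) (by positivity), Real.log_mul (by positivity) (by positivity),
      Real.log_mul (by positivity) (by positivity), Real.log_mul (by positivity) (by positivity)]
    linarith
  exact ⟨hy1, hL2, b1, b2, b3⟩

theorem episodes_le {H N M K : ℕ} {ζ ε δ : ℝ} {m : SampleSizes} (hε : 0 < ε) (hε1 : ε < 1)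
    (hδ : 0 < δ) (hH : 0 < H) (hN : 0 < N) (hM : 0 < M) (hK : 0 < K) (hζ : 0 < ζ)
    (hL : 1 ≤ Real.log (6 * H * √M * ζ / ε))
    (h1 : m.nEst = ⌈32 / ε ^ 2 * Real.log (6 * N / δ)⌉₊)
    (h2 : m.nEval = ⌈288 * H ^ 2 / ε ^ 2 *
      Real.log (12 * H ^ 2 * M * Real.log (6 * H * √M * ζ / ε) / δ)⌉₊)
    (h3 : m.nExp = ⌈4608 * H ^ 2 * M * K / ε ^ 2 *
      Real.log (12 * N * H * M * Real.log (6 * H * √M * ζ / ε) / δ)⌉₊)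
    {s : ℕ} (hs : (s + 1 : ℝ) ≤ 2 * H * M * Real.log (6 * H * √M * ζ / ε)) :
    (episodes m s : ℝ) ≤ 250000 * (M ^ 2 * H ^ 3 * K / ε ^ 2 * max 1 (Real.log (N * ζ / δ))) *
      (1 + Real.log (M * H * K * (1 + ζ) / ε)) ^ 2 := by
  have hH' : (1 : ℝ) ≤ H := by exact_mod_cast hH
  have hM' : (1 : ℝ) ≤ M := by exact_mod_cast hM
  have hK' : (1 : ℝ) ≤ K := by exact_mod_cast hK
  have hMK : (1 : ℝ) ≤ M * K := one_le_mul_of_one_le_of_one_le hM' hK'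
  obtain ⟨hy1, hL2, b1, b2, b3⟩ := log_bounds hε hε1 hδ hH hN hM hK hζ hL rfl rfl rfl
  set L := Real.log (6 * H * √M * ζ / ε)
  set μ := max 1 (Real.log (N * ζ / δ))
  have hμ1 : 1 ≤ μ := le_max_left _ _
  set y := 1 + Real.log (M * H * K * (1 + ζ) / ε)
  have hε2 : 1 ≤ (ε ^ 2)⁻¹ := (one_le_inv₀ (by positivity)).2 (by nlinarith)
  set e := (ε ^ 2)⁻¹ with he
  have hμy1 : 1 ≤ μ * y := one_le_mul_of_one_le_of_one_le hμ1 hy1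
  set w := μ * y * e with hw
  have hw1 : 1 ≤ w := one_le_mul_of_one_le_of_one_le hμy1 hε2
  -- As `a * w ≥ 1`, rounding up only replaces `b` by `b + 1`.
  have hceil : ∀ {n : ℕ} {a l b : ℝ}, 1 ≤ a → l ≤ b * (μ * y) → 0 ≤ b → n = ⌈a * e * l⌉₊ →
      (n : ℝ) ≤ (b + 1) * a * w := by
    intro n a l b ha hl hb hn
    have hle : a * e * l ≤ b * a * w := by
      calc a * e * l ≤ a * e * (b * (μ * y)) := by gcongr
        _ = b * a * w := by rw [hw]; ring
    have h0 : 0 ≤ b * a * w := by positivity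
    have haw : 1 ≤ a * w := one_le_mul_of_one_le_of_one_le ha hw1
    calc (n : ℝ) ≤ (⌈b * a * w⌉₊ : ℝ) := by rw [hn]; exact_mod_cast Nat.ceil_le_ceil hle
      _ ≤ b * a * w + 1 := (Nat.ceil_lt_add_one h0).le
      _ ≤ (b + 1) * a * w := by nlinarith
  have hH2 : (1 : ℝ) ≤ H ^ 2 := one_le_pow₀ hH'
  have n1 := hceil (n := m.nEst) (a := 32) (by norm_num) b1 (by norm_num) (by
    rw [h1, he, div_eq_mul_inv])
  have n2 := hceil (n := m.nEval) (a := 288 * H ^ 2) (by linarith) b2 (by norm_num) (by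
    rw [h2, he, div_eq_mul_inv])
  have n3 := hceil (n := m.nExp) (a := 4608 * H ^ 2 * M * K) (by
    have : (1 : ℝ) ≤ H ^ 2 * (M * K) := one_le_mul_of_one_le_of_one_le hH2 hMK
    nlinarith) b3 (by norm_num) (by
    rw [h3, he, div_eq_mul_inv])
  have hs' : (s + 1 : ℝ) ≤ 4 * H * M * y := by
    refine hs.trans ?_
    calc (2 * H * M * L : ℝ) ≤ 2 * H * M * (2 * y) := by gcongr
      _ = _ := by ring
  have hepis : (episodes m s : ℝ) ≤ m.nEst + (s + 1) * (m.nEval + m.nExp) := by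
    rw [episodes]
    push_cast
    have : (0 : ℝ) ≤ m.nExp := by positivity
    linarith
  have hH3 : (1 : ℝ) ≤ H ^ 3 := one_le_pow₀ hH'
  have hM2 : (1 : ℝ) ≤ M ^ 2 := one_le_pow₀ hM'
  have hbig : (1 : ℝ) ≤ M ^ 2 * H ^ 3 * K * y := one_le_mul_of_one_le_of_one_le
    (one_le_mul_of_one_le_of_one_le (one_le_mul_of_one_le_of_one_le hM2 hH3) hK') hy1
  calc (episodes m s : ℝ) ≤ m.nEst + (s + 1) * (m.nEval + m.nExp) := hepis
    _ ≤ (5 + 1) * 32 * w + 4 * H * M * y * ((11 + 1) * (288 * H ^ 2) * w +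
        (10 + 1) * (4608 * H ^ 2 * M * K) * w) := by gcongr
    _ ≤ (5 + 1) * 32 * w * (M ^ 2 * H ^ 3 * K * y) +
        4 * H * M * y * ((11 + 1) * (288 * H ^ 2) * w * (M * K) +
        (10 + 1) * (4608 * H ^ 2 * M * K) * w) := by
        exact add_le_add (le_mul_of_one_le_right (by positivity) hbig)
          (mul_le_mul_of_nonneg_left (add_le_add (le_mul_of_one_le_right (by positivity) hMK)
            le_rfl) (by positivity))
    -- One factor `y` comes from the number of iterations and one from the sample sizes, whence `k =
    -- 2`.
    _ = (192 + 13824 + 202752) * (M ^ 2 * H ^ 3 * K * e * μ) * y ^ 2 := by rw [hw]; ring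
    _ ≤ 250000 * (M ^ 2 * H ^ 3 * K * e * μ) * y ^ 2 := by gcongr; norm_num
    _ = _ := by rw [he, div_eq_mul_inv]

end SampleSizes

end OLIVE

/-! ### The theorem: choice of `T` and of the error budget -/

theorem theorem1 :
    ∃ (c : ℝ) (k : ℕ), 0 < c ∧
      ∀ (X : Type u) (A : Type v) [MeasurableSpace X] [MeasurableSpace A]
        [MeasurableSingletonClass A] [Fintype A] [DecidableEq A] [Nonempty A]
        (H N M : ℕ) (ζ ε δ φ : ℝ) (m : OLIVE.SampleSizes)
        (C : OLIVE.CDP X A H) (F : OLIVE.ValueClass X A N),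
        0 < ε → ε < 1 → 0 < δ → δ < 1 → 0 < H → 0 < M →
        C.BoundedRewards →
        (∃ i, OLIVE.Valid C F i) →
        OLIVE.BellmanFactorization C F M ζ →
        1 ≤ Real.log (6 * H * √M * ζ / ε) →
        φ = ε / (12 * H * √M) →
        m.nEst = ⌈32 / ε ^ 2 * Real.log (6 * N / δ)⌉₊ →
        m.nEval = ⌈288 * H ^ 2 / ε ^ 2 *
          Real.log (12 * H ^ 2 * M * Real.log (6 * H * √M * ζ / ε) / δ)⌉₊ →
        m.nExp = ⌈4608 * H ^ 2 * M * Fintype.card A / ε ^ 2 *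
          Real.log (12 * N * H * M * Real.log (6 * H * √M * ζ / ε) / δ)⌉₊ →
        ∀ S : OLIVE.Choices C F m ε φ, ∃ T : ℕ,
          ENNReal.ofReal (1 - δ) ≤ S.law T
            {ω | ∃ s : Fin T, OLIVE.HaltsAt F ε φ ω s ∧
              OLIVE.optValue C F - ε ≤ C.value (OLIVE.output F ω s) ∧
              (OLIVE.episodes m s : ℝ) ≤
                c * (M ^ 2 * H ^ 3 * Fintype.card A / ε ^ 2 *
                  max 1 (Real.log (N * ζ / δ))) *
                (1 + Real.log (M * H * Fintype.card A * (1 + ζ) / ε)) ^ k} := by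
  refine ⟨250000, 2, by norm_num, ?_⟩
  intro X A _ _ _ _ _ _ H N M ζ ε δ φ m C F hε hε1 hδ hδ1 hH hM hC hv hf hL hφ h1 h2 h3 S
  obtain ⟨i₀, -⟩ := id hv
  have hN : 0 < N := i₀.pos
  have hK : 0 < Fintype.card A := Fintype.card_pos
  have hζ : 0 < ζ := hf.pos hH i₀ (x := 6 * H * √M / ε) (by
    rwa [show 6 * H * √M / ε * ζ = 6 * H * √M * ζ / ε by ring])
  have hepis := fun s hs => OLIVE.episodes_le (s := s) hε hε1 hδ hH hN hM hK hζ hL h1 h2 h3 hs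
  set L := Real.log (6 * H * √M * ζ / ε)
  have hH' : (1 : ℝ) ≤ H := by exact_mod_cast hH
  have hN' : (1 : ℝ) ≤ N := by exact_mod_cast hN
  have hM' : (1 : ℝ) ≤ M := by exact_mod_cast hM
  have hK' : (1 : ℝ) ≤ Fintype.card A := by exact_mod_cast hK
  have hsM : 1 ≤ √(M : ℝ) := Real.one_le_sqrt.2 hM'
  have hL0 : 0 < L := by linarith
  have hHML : 1 ≤ H * M * L := one_le_mul_of_one_le_of_one_le
    (one_le_mul_of_one_le_of_one_le hH' hM') hL
  have hQ1 : 1 < 6 * N / δ := by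
    rw [one_lt_div hδ]
    linarith
  have hQ2 : 1 < 12 * H ^ 2 * M * L / δ := by
    rw [one_lt_div hδ]
    nlinarith
  have hQ3 : 1 < 12 * N * H * M * L / δ := by
    rw [one_lt_div hδ]
    nlinarith
  have hφ0 : 0 < φ := by
    rw [hφ]
    positivity
  have hφ4 : φ ≤ 4 := by
    have : 1 ≤ H * √M := one_le_mul_of_one_le_of_one_le hH' hsM
    rw [hφ, div_le_iff₀ (by positivity)]
    nlinarith
  have l1 := Real.log_pos hQ1
  have l2 := Real.log_pos hQ2
  have l3 := Real.log_pos hQ3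
  have n1 : 0 < m.nEst := by
    rw [h1]
    exact Nat.ceil_pos.2 (by positivity)
  have n2 : 0 < m.nEval := by
    rw [h2]
    exact Nat.ceil_pos.2 (by positivity)
  have n3 : 0 < m.nExp := by
    rw [h3]
    exact Nat.ceil_pos.2 (by positivity)
  have hφ2 : φ ^ 2 = ε ^ 2 / (144 * H ^ 2 * M) := by
    rw [hφ, div_pow, mul_pow, mul_pow, Real.sq_sqrt (by positivity)]
    norm_num
  -- The constants 32, 288 and 4608 make the prefactor of each sample size times the rate `x` equal
  -- to 1.
  have p1 := OLIVE.two_mul_exp_neg_le (x := 2 * (ε / 8) ^ 2) hQ1.le (by positivity)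
    (le_of_eq (by field_simp; norm_num)) h1
  have p2 := OLIVE.two_mul_exp_neg_le (x := 2 * (ε / (8 * H)) ^ 2 / 9) hQ2.le (by positivity)
    (le_of_eq (by field_simp; norm_num)) h2
  have p3 := OLIVE.two_mul_exp_neg_le (x := φ ^ 2 / (16 * Fintype.card A)) hQ3.le (by positivity)
    (by rw [hφ2]; field_simp; norm_num) h3
  refine ⟨⌊2 * H * M * L⌋₊, ?_⟩
  set T := ⌊2 * H * M * L⌋₊
  have hT : (T : ℝ) ≤ 2 * H * M * L := Nat.floor_le (by positivity)
  have hT' : 2 * H * M * L - 1 < T := by linarith [Nat.lt_floor_add_one (2 * H * M * L)]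
  have hbad := S.law_not_goodRun_le hC hε.le hφ0.le hφ4 n1 n2 n3 T p1 p2 p3
  -- The initial estimates cost `δ/3`; each of at most `2HML` iterations costs `δ / (3HML)`, half
  -- for evaluation and half for exploration.
  have hsum : N * (2 / (6 * N / δ)) + T * (H * (2 / (12 * H ^ 2 * M * L / δ)) +
      N * (2 / (12 * N * H * M * L / δ))) ≤ δ := by
    have e1 : N * (2 / (6 * N / δ)) = δ / 3 := by
      field_simp
      norm_num
    have e2 : H * (2 / (12 * H ^ 2 * M * L / δ)) + N * (2 / (12 * N * H * M * L / δ)) =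
        δ / (3 * (H * M * L)) := by
      field_simp
      norm_num
    rw [e1, e2]
    calc δ / 3 + T * (δ / (3 * (H * M * L)))
        ≤ δ / 3 + 2 * H * M * L * (δ / (3 * (H * M * L))) := by gcongr
      _ = δ := by
        field_simp
        norm_num
  have hgood : {ω | OLIVE.GoodRun C F ε φ ω} ⊆ {ω : OLIVE.Run X A H N m T | ∃ s : Fin T,
      OLIVE.HaltsAt F ε φ ω s ∧ OLIVE.optValue C F - ε ≤ C.value (OLIVE.output F ω s) ∧
      (OLIVE.episodes m s : ℝ) ≤ 250000 * (M ^ 2 * H ^ 3 * Fintype.card A / ε ^ 2 *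
        max 1 (Real.log (N * ζ / δ))) *
        (1 + Real.log (M * H * Fintype.card A * (1 + ζ) / ε)) ^ 2} := by
    intro ω hω
    obtain ⟨s, hs, hval⟩ := OLIVE.GoodRun.exists_haltsAt hω hC hε hH hM hv hf hL hφ hζ hT'
    refine ⟨s, hs, hval, hepis s (le_trans ?_ hT)⟩
    exact_mod_cast s.isLt
  refine le_trans ?_ (MeasureTheory.measure_mono hgood)
  rw [ENNReal.ofReal_sub _ hδ.le, ENNReal.ofReal_one, tsub_le_iff_right]
  calc (1 : ENNReal) = S.law T Set.univ := MeasureTheory.measure_univ.symm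
    -- Subadditivity suffices here, so measurability of the good event is not needed.
    _ ≤ S.law T ({ω | OLIVE.GoodRun C F ε φ ω} ∪ {ω | ¬ OLIVE.GoodRun C F ε φ ω}) :=
        MeasureTheory.measure_mono fun ω _ => em _
    _ ≤ S.law T {ω | OLIVE.GoodRun C F ε φ ω} + S.law T {ω | ¬ OLIVE.GoodRun C F ε φ ω} :=
        MeasureTheory.measure_union_le _ _
    _ ≤ _ := by
        gcongr
        exact hbad.trans (ENNReal.ofReal_le_ofReal hsum)
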